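/- **Setting.** Let $(Y,X)\in[0,1]^2$ have conditional density $f_{Y|X}(y|x)$, conditional distribution function $F_{Y|X}(y|x)=\int_0^y f_{Y|X}(t|x)\,dt$ and marginal density $f_X$. For a price $y\in[0,1]$ let $r(y,x)=y\,(1-F_{Y|X}(y|x))$, and for a measurable pricing function $p:[0,1]\to[0,1]$ let $R(p)=\int_0^1 r(p(x),x)f_X(x)\,dx$. Let $p_D^*$ be the optimal pricing function, i.e. $R(p_D^*)=\sup_p R(p)$, with $p_D^*(x)$ a maximizer of $r(\cdot,x)$ over $[0,1]$ for every $x\in[0,1]$. For positive constants $C_0,C^*,\overline C,\overline C',\underline C$ let $\mathcal F$ be the class of all joint distributions of $(Y,X)$ such that (a) $|f_{Y|X}(y|x)-f_{Y|X}(y'|x)|\le C_0|y-y'|$ for all $x,y,y'\in[0,1]$; (b) $r(\cdot,x)$ is strictly concave on $[0,1]$ for every $x\in[0,1]$, and $-2f_{Y|X}(y|x)-y\,\partial_y f_{Y|X}(y|x)\le -C^*$ for a.e. $(y,x)\in[0,1]^2$; (c) for every $x\in[0,1]$ the optimal price lies in $(0,1)$; (d) $F_{Y|X}(y|x)$ and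 $f_{Y|X}(y|x)$ are continuously differentiable in $(y,x)$ in a neighborhood, relative to $[0,1]^2$, of the curve of optimal prices $\{(p_D^*(x),x):x\in[0,1]\}$; (e) for a.e. $(y,x)\in[0,1]^2$, $|2f_{Y|X}(y|x)+y\,\partial_y f_{Y|X}(y|x)|\le\overline C$, and the partial derivatives $\partial_x F_{Y|X}(y|x)$, $\partial_x f_{Y|X}(y|x)$ exist and satisfy $|\partial_x F_{Y|X}(y|x)+y\,\partial_x f_{Y|X}(y|x)|\le\overline C$; (f) $\underline C\le f_X\le\overline C'$ on $[0,1]$. Let $1\le K\le n$ and let $(Y_1,X_1),\dots,(Y_n,X_n)$ be i.i.d. with the law of $(Y,X)$. The *$K$-markets ERM strategy* splits $[0,1)$ into the cells $I_k=[(k-1)/K,k/K)$, $k=1,\dots,K$, and charges at every $x\in I_k$ a price $\hat p_D(x)=\hat p_k\in[0,1]$ that maximizes the empirical revenue $$p\ \longmapsto\ p\cdot\frac{\#\{i: X_i\in I_k,\ Y_i\ge p\}}{n_k},\qquad n_k=\#\{i:X_i\in I_k\},$$ over $p\in[0,1]$ (ties are broken by any measurable rule; if $n_k=0$ any price in $[0,1]$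 may be charged). **Theorem 4.** There is a constant $C\in(0,\infty)$ depending only on $C_0,C^*,\overline C,\overline C',\underline C$ such that for all $1\le K\le n$ and every $K$-markets ERM strategy $\hat p_D$: (i) for every $x_0\in[0,1)$, $$\sup_{F_{Y,X}\in\mathcal F}\Big(r(p_D^*(x_0),x_0)-\mathbb E_{F_{Y,X}}\big[r(\hat p_D(x_0),x_0)\big]\Big)\le C\left((K/n)^{2/3}+\frac1{K^2}\right);$$ (ii) $$\sup_{F_{Y,X}\in\mathcal F}\Big(R(p_D^*)-\mathbb E_{F_{Y,X}}\big[R(\hat p_D)\big]\Big)\le C\left((K/n)^{2/3}+\frac1{K^2}\right).$$ Moreover $(K/n)^{2/3}+1/K^2\asymp n^{-1/2}$ when $K\asymp n^{1/4}$: for all $a,b>0$ there are $c_1,c_2>0$ such that $c_1n^{-1/2}\le (K/n)^{2/3}+1/K^2\le c_2n^{-1/2}$ for all integers $n,K\ge1$ with $a\,n^{1/4}\le K\le b\,n^{1/4}$. -/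

import Mathlib

open MeasureTheory

noncomputable section

/-- A joint distribution of `(Y, X)` on `[0,1]²`, given by a conditional density
`(y, x) ↦ f_{Y|X}(y|x)` and a marginal density `f_X`. Only values on `[0,1]` matter. -/
structure JointModel where
  condDensity : ℝ → ℝ → ℝ
  margDensity : ℝ → ℝ
  measurable_condDensity : Measurable (fun z : ℝ × ℝ => condDensity z.1 z.2)
  measurable_margDensity : Measurable margDensity
  condDensity_nonneg : ∀ y ∈ Set.Icc (0 : ℝ) 1, ∀ x ∈ Set.Icc (0 : ℝ) 1, 0 ≤ condDensity y x
  margDensity_nonneg : ∀ x ∈ Set.Icc (0 : ℝ) 1, 0 ≤ margDensity x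
  integral_condDensity : ∀ x ∈ Set.Icc (0 : ℝ) 1, ∫ y in (0 : ℝ)..1, condDensity y x = 1
  integral_margDensity : ∫ x in (0 : ℝ)..1, margDensity x = 1

namespace JointModel

/-- The closed unit square. -/
def unitSquare : Set (ℝ × ℝ) := Set.Icc (0 : ℝ) 1 ×ˢ Set.Icc (0 : ℝ) 1

/-- The law of `(Y, X)`: density `f_{Y|X}(y|x) f_X(x)` on the unit square. -/
def law (M : JointModel) : Measure (ℝ × ℝ) :=
  (volume.restrict unitSquare).withDensity
    (fun z => ENNReal.ofReal (M.condDensity z.1 z.2 * M.margDensity z.2))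

/-- The law of an i.i.d. sample `(Y₁, X₁), …, (Yₙ, Xₙ)`. -/
def sampleLaw (M : JointModel) (n : ℕ) : Measure (Fin n → ℝ × ℝ) :=
  Measure.pi (fun _ => M.law)

/-- The conditional distribution function `F_{Y|X}(y|x)`. -/
def condCDF (M : JointModel) (y x : ℝ) : ℝ := ∫ t in (0 : ℝ)..y, M.condDensity t x

/-- The revenue `r(y, x) = (1 - F_{Y|X}(y|x)) y` of the price `y` at the covariate value `x`. -/
def revenue (M : JointModel) (y x : ℝ) : ℝ := (1 - M.condCDF y x) * y

/-- The expected revenue `R(p)` of a pricing function `p`. -/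
def expectedRevenue (M : JointModel) (p : ℝ → ℝ) : ℝ :=
  ∫ x in (0 : ℝ)..1, M.revenue (p x) x * M.margDensity x

/-- `y` is an optimal price at the covariate value `x`. -/
def IsOptimalPrice (M : JointModel) (x y : ℝ) : Prop :=
  y ∈ Set.Icc (0 : ℝ) 1 ∧ ∀ z ∈ Set.Icc (0 : ℝ) 1, M.revenue z x ≤ M.revenue y x

end JointModel

/-- Measurable pricing functions `[0,1] → [0,1]` (values outside `[0,1]` are irrelevant). -/
def pricingFunctions : Set (ℝ → ℝ) :=
  {p | Measurable p ∧ ∀ x ∈ Set.Icc (0 : ℝ) 1, p x ∈ Set.Icc (0 : ℝ) 1}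

namespace JointModel

/-- `p` is the true-distribution optimal pricing function: it maximizes the expected revenue over
all pricing functions, in the version that is optimal at every covariate value. -/
def IsOptimalPricing (M : JointModel) (p : ℝ → ℝ) : Prop :=
  p ∈ pricingFunctions ∧
  (∀ q ∈ pricingFunctions, M.expectedRevenue q ≤ M.expectedRevenue p) ∧
  (∀ x ∈ Set.Icc (0 : ℝ) 1, M.IsOptimalPrice x (p x))

/-- The class of joint distributions with constants `C₀` (Lipschitz), `Cs` (strong concavity),
`Cb` (bounds on derivatives), `Cu` and `Cl` (upper and lower bound of the marginal density). -/
structure InClass (M : JointModel) (C₀ Cs Cb Cu Cl : ℝ) : Prop where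
  /-- Lipschitz continuity of the conditional density in `y`. -/
  lipschitz : ∀ x ∈ Set.Icc (0 : ℝ) 1, ∀ y ∈ Set.Icc (0 : ℝ) 1, ∀ y' ∈ Set.Icc (0 : ℝ) 1,
    |M.condDensity y x - M.condDensity y' x| ≤ C₀ * |y - y'|
  /-- Strict concavity of the revenue in the price. -/
  strictConcave : ∀ x ∈ Set.Icc (0 : ℝ) 1,
    StrictConcaveOn ℝ (Set.Icc (0 : ℝ) 1) (fun y => M.revenue y x)
  /-- Bound on the second derivative of the revenue. -/
  strongConcave : ∀ᵐ z ∂(volume.restrict unitSquare : Measure (ℝ × ℝ)),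
    -2 * M.condDensity z.1 z.2 - z.1 * deriv (fun y => M.condDensity y z.2) z.1 ≤ -Cs
  /-- Optimal prices are interior. -/
  interior : ∀ x ∈ Set.Icc (0 : ℝ) 1, ∀ y, M.IsOptimalPrice x y → y ∈ Set.Ioo (0 : ℝ) 1
  /-- The conditional distribution function and its density are `C¹` in a neighbourhood
  (relative to the unit square) of the curve of optimal prices. -/
  smooth : ∃ U : Set (ℝ × ℝ), IsOpen U ∧
    (∀ x ∈ Set.Icc (0 : ℝ) 1, ∀ y, M.IsOptimalPrice x y → (y, x) ∈ U) ∧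
    ContDiffOn ℝ 1 (fun z : ℝ × ℝ => M.condCDF z.1 z.2) (U ∩ unitSquare) ∧
    ContDiffOn ℝ 1 (fun z : ℝ × ℝ => M.condDensity z.1 z.2) (U ∩ unitSquare)
  /-- Boundedness of the derivative of the marginal revenue in `y`. -/
  bounded_y : ∀ᵐ z ∂(volume.restrict unitSquare : Measure (ℝ × ℝ)),
    |2 * M.condDensity z.1 z.2 + z.1 * deriv (fun y => M.condDensity y z.2) z.1| ≤ Cb
  /-- Existence and boundedness of the derivative of the marginal revenue in `x`. -/
  bounded_x : ∀ᵐ z ∂(volume.restrict unitSquare : Measure (ℝ × ℝ)),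
    DifferentiableAt ℝ (fun x => M.condCDF z.1 x) z.2 ∧
    DifferentiableAt ℝ (fun x => M.condDensity z.1 x) z.2 ∧
    |deriv (fun x => M.condCDF z.1 x) z.2 + z.1 * deriv (fun x => M.condDensity z.1 x) z.2| ≤ Cb
  /-- Bounds on the marginal density. -/
  marginal : ∀ x ∈ Set.Icc (0 : ℝ) 1, Cl ≤ M.margDensity x ∧ M.margDensity x ≤ Cu

end JointModel

/-- The `k`-th of the `K` markets, `k = 0, …, K - 1`. -/
def market (K : ℕ) (k : Fin K) : Set ℝ :=
  Set.Ico ((k : ℝ) / K) (((k : ℝ) + 1) / K)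

/-- The number `n_k` of observations in the `k`-th market. -/
def marketCount {n : ℕ} (K : ℕ) (data : Fin n → ℝ × ℝ) (k : Fin K) : ℝ :=
  ∑ i, Set.indicator {z : ℝ × ℝ | z.2 ∈ market K k} (fun _ => (1 : ℝ)) (data i)

/-- The empirical revenue of the price `p` in the `k`-th market: `p` times the fraction of the
observed valuations in that market that are at least `p` (zero in an empty market). The inequality
`p ≤ Y_i` is weak, since with `p < Y_i` the supremum over `p` would not be attained. -/
def empiricalRevenue {n : ℕ} (K : ℕ) (data : Fin n → ℝ × ℝ) (k : Fin K) (p : ℝ) : ℝ :=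
  p * ((∑ i, Set.indicator {z : ℝ × ℝ | z.2 ∈ market K k ∧ p ≤ z.1} (fun _ => (1 : ℝ)) (data i))
    / marketCount K data k)

/-- `phat` is a `K`-markets ERM strategy: a measurable choice of an empirically revenue-maximizing
price in every market. In a market without observations every price in `[0,1]` is allowed. -/
def IsKMarketsERM {n K : ℕ} (phat : (Fin n → ℝ × ℝ) → Fin K → ℝ) : Prop :=
  Measurable phat ∧ ∀ data k, phat data k ∈ Set.Icc (0 : ℝ) 1 ∧
    ∀ q ∈ Set.Icc (0 : ℝ) 1,
      empiricalRevenue K data k q ≤ empiricalRevenue K data k (phat data k)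

/-- The pricing function that charges `p k` on the `k`-th market (and `0` at covariate `1`). -/
def marketPricing {K : ℕ} (p : Fin K → ℝ) (x : ℝ) : ℝ :=
  ∑ k, Set.indicator (market K k) (fun _ => p k) x

end

/-! The first-order condition holds at the interior optimum and the marginal revenue is Lipschitz in
the price, so the revenue loss is at most quadratic in the price error
(`InClass.revenue_optimal_sub_le`). It therefore suffices to bound the mean squared distance between
the price charged in a market and `pstar x₀`, for any `x₀` of that market
(`exists_integral_sq_sub_le`). Integrating the pointwise bound against the marginal density, with
Fubini, then gives the bound on expected revenue.

The squared error has two sources. The first is bias: an implicit-function argument makes the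
optimal price Lipschitz in the covariate (`InClass.optimalPrice_lipschitz`), so it varies by
`O(1/K)` within a market. Strong concavity then makes the revenue aggregated over the market fall
quadratically at distances from `pstar x₀` above a multiple of `1/K`
(`InClass.market_revenue_drift`).

The second is noise, at the cube-root rate. Put `lam = n/K`. An empirical maximizer at distance
about `η` must overcome a drift of order `lam * η ^ 2` (`drift_le_deviation`), while counts over
price intervals of length `η` fluctuate by about `(lam * η) ^ (1/2)`. The two balance at `η = lam ^
(-1/3)`. Chaining with fourth moments bounds the probability of such a deviation by `C / (lam * η ^
3)` (`exists_tail_bound_monotone_family`). Second moments would not do: the union bound over `2 ^ l`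
cells would cancel the variance gain `2 ^ (-l)` before the thresholds even shrink. The cubic tail is
summable against `η ^ 2` over dyadic shells (`integral_sq_le_of_shell_bound`), so the mean squared
error is of the order of the squared larger scale. -/

/-- The deviation of the number of sample points in `A` from its mean. -/
noncomputable def countDeviation {α : Type*} [MeasurableSpace α] {n : ℕ} (ν : Measure α) (A : Set α)
    (z : Fin n → α) : ℝ :=
  ∑ i, (A.indicator (fun _ => (1 : ℝ)) (z i) - ν.real A)

/-! ### Moments and tail bounds for centred counts -/

lemma integrable_of_abs_le {Ω : Type*} [MeasurableSpace Ω] {μ : Measure Ω} [IsFiniteMeasure μ]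
    {f : Ω → ℝ} (hf : Measurable f) {B : ℝ} (hB : ∀ ω, |f ω| ≤ B) : Integrable f μ :=
  Integrable.of_bound hf.aestronglyMeasurable B (Filter.Eventually.of_forall hB)

-- Induction on the index set: the new variable is independent of the partial sum and both are
-- centred, so every cross term containing a first power integrates to zero. In the fourth moment
-- only `6 * S ^ 2 * X ^ 2` survives, which is exactly the cross term of `3 * (card * v) ^ 2`.
open ProbabilityTheory in
lemma sum_moments_of_iIndepFun {Ω ι : Type*} [MeasurableSpace Ω] {μ : Measure Ω}
    [IsProbabilityMeasure μ] {X : ι → Ω → ℝ} (hind : iIndepFun X μ) (hX : ∀ i, Measurable (X i))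
    (hb : ∀ i ω, |X i ω| ≤ 1) {v : ℝ} (h1 : ∀ i, ∫ ω, X i ω ∂μ = 0)
    (h2 : ∀ i, ∫ ω, X i ω ^ 2 ∂μ ≤ v) (s : Finset ι) :
    ∫ ω, (∑ i ∈ s, X i ω) ∂μ = 0 ∧ ∫ ω, (∑ i ∈ s, X i ω) ^ 2 ∂μ ≤ s.card * v ∧
      ∫ ω, (∑ i ∈ s, X i ω) ^ 4 ∂μ ≤ s.card * v + 3 * (s.card * v) ^ 2 := by
  classical
  induction s using Finset.induction_on with
  | empty => simp
  | insert a s ha ih =>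
    obtain ⟨i1, i2, i4⟩ := ih
    set S : Ω → ℝ := fun ω => ∑ i ∈ s, X i ω with hS
    have hSm : Measurable S := Finset.measurable_sum _ fun i _ => hX i
    have hSb : ∀ ω, |S ω| ≤ s.card := fun ω =>
      (Finset.abs_sum_le_sum_abs _ _).trans
        ((Finset.sum_le_sum fun i _ => hb i ω).trans (by simp))
    have hSX : IndepFun S (X a) μ := by
      have := hind.indepFun_finsetSum_of_notMem hX ha
      convert this using 1
      ext ω; simp [hS]
    have hint : ∀ j k : ℕ, Integrable (fun ω => S ω ^ j * X a ω ^ k) μ := fun j k => by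
      refine integrable_of_abs_le ((hSm.pow_const j).mul ((hX a).pow_const k))
        (B := (s.card : ℝ) ^ j * 1) fun ω => ?_
      rw [abs_mul, abs_pow, abs_pow]
      exact mul_le_mul (pow_le_pow_left₀ (abs_nonneg _) (hSb ω) _)
        (pow_le_one₀ (abs_nonneg _) (hb a ω)) (by positivity) (by positivity)
    have hprod : ∀ j k : ℕ, ∫ ω, S ω ^ j * X a ω ^ k ∂μ
        = (∫ ω, S ω ^ j ∂μ) * ∫ ω, X a ω ^ k ∂μ := fun j k =>
      (hSX.comp (measurable_id.pow_const j) (measurable_id.pow_const k)).integral_fun_mul_eq_mul_integral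
        (hSm.pow_const j).aestronglyMeasurable ((hX a).pow_const k).aestronglyMeasurable
    have hX2 : 0 ≤ ∫ ω, X a ω ^ 2 ∂μ := integral_nonneg fun ω => by positivity
    have hv : 0 ≤ v := hX2.trans (h2 a)
    have hXi : ∀ k : ℕ, Integrable (fun ω => X a ω ^ k) μ := fun k => by simpa using hint 0 k
    -- Since the variable is bounded by one, its fourth power is dominated by its square; this is
    -- why a single variance parameter suffices.
    have hX4 : ∫ ω, X a ω ^ 4 ∂μ ≤ v := by
      refine le_trans (integral_mono (hXi 4) (hXi 2) fun ω => ?_) (h2 a)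
      have : X a ω ^ 2 ≤ 1 := by
        rw [← sq_abs]; exact pow_le_one₀ (abs_nonneg _) (hb a ω)
      show X a ω ^ 4 ≤ X a ω ^ 2
      nlinarith [sq_nonneg (X a ω)]
    have e1 : ∫ ω, X a ω ^ 1 ∂μ = 0 := by simpa using h1 a
    have hsum : ∀ ω, ∑ i ∈ insert a s, X i ω = S ω + X a ω := fun ω => by
      rw [Finset.sum_insert ha, add_comm]
    simp only [hsum, Finset.card_insert_of_notMem ha]
    push_cast
    refine ⟨?_, ?_, ?_⟩
    · rw [integral_add (by simpa using hint 1 0) (by simpa using hint 0 1), h1 a, i1, add_zero]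
    · have : ∀ ω, (S ω + X a ω) ^ 2
          = S ω ^ 2 * X a ω ^ 0 + 2 * (S ω ^ 1 * X a ω ^ 1) + S ω ^ 0 * X a ω ^ 2 :=
        fun ω => by ring
      simp only [this]
      rw [integral_add ((hint 2 0).fun_add ((hint 1 1).const_mul 2)) (hint 0 2),
        integral_add (hint 2 0) ((hint 1 1).const_mul 2), integral_const_mul, hprod 1 1, e1]
      simp only [pow_zero, mul_one, one_mul]
      linarith [h2 a]
    · have : ∀ ω, (S ω + X a ω) ^ 4
          = S ω ^ 4 * X a ω ^ 0 + 4 * (S ω ^ 3 * X a ω ^ 1) + 6 * (S ω ^ 2 * X a ω ^ 2)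
            + 4 * (S ω ^ 1 * X a ω ^ 3) + S ω ^ 0 * X a ω ^ 4 :=
        fun ω => by ring
      simp only [this]
      have i40 := hint 4 0
      have i31 := (hint 3 1).const_mul 4
      have i22 := (hint 2 2).const_mul 6
      have i13 := (hint 1 3).const_mul 4
      rw [integral_add (((i40.fun_add i31).fun_add i22).fun_add i13) (hint 0 4),
        integral_add ((i40.fun_add i31).fun_add i22) i13, integral_add (i40.fun_add i31) i22,
        integral_add i40 i31, integral_const_mul, integral_const_mul, integral_const_mul,
        hprod 3 1, hprod 2 2, hprod 1 3, e1]
      have e2 : ∫ ω, S ω ^ 1 ∂μ = 0 := by simpa using i1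
      rw [e2]
      simp only [pow_zero, mul_one, one_mul]
      have : (∫ ω, S ω ^ 2 ∂μ) * ∫ ω, X a ω ^ 2 ∂μ ≤ (s.card * v) * v :=
        mul_le_mul i2 (h2 a) hX2 (by positivity)
      nlinarith [sq_nonneg v]

section countDeviation

variable {α : Type*} [MeasurableSpace α] {ν : Measure α} {n : ℕ}

lemma measurable_countDeviation {A : Set α} (hA : MeasurableSet A) :
    Measurable (countDeviation (n := n) ν A) :=
  Finset.measurable_sum _ fun i _ =>
    ((measurable_const.indicator hA).comp (measurable_pi_apply i)).sub_const _

lemma abs_countDeviation_le [IsProbabilityMeasure ν] (A : Set α) (z : Fin n → α) :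
    |countDeviation ν A z| ≤ n := by
  refine (Finset.abs_sum_le_sum_abs _ _).trans ((Finset.sum_le_sum (g := fun _ => (1 : ℝ))
    fun i _ => ?_).trans (by simp))
  have h0 : 0 ≤ ν.real A := measureReal_nonneg
  have h1 : ν.real A ≤ 1 := measureReal_le_one
  by_cases h : z i ∈ A <;> simp only [h, Set.indicator_of_mem, Set.indicator_of_notMem,
    not_false_eq_true] <;> rw [abs_le] <;> constructor <;> linarith

/-- A centred indicator has variance at most the probability of its set, so the moment bounds for
independent sums apply with `v = ν.real A`. The linear term remains in the fourth moment because the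
expected count may be small. -/
lemma countDeviation_moments [IsProbabilityMeasure ν] {A : Set α} (hA : MeasurableSet A) :
    ∫ z, countDeviation ν A z ^ 2 ∂(Measure.pi fun _ : Fin n => ν) ≤ n * ν.real A ∧
    ∫ z, countDeviation ν A z ^ 4 ∂(Measure.pi fun _ : Fin n => ν)
      ≤ n * ν.real A + 3 * (n * ν.real A) ^ 2 := by
  have h0 : 0 ≤ ν.real A := measureReal_nonneg
  have h1 : ν.real A ≤ 1 := measureReal_le_one
  set g : α → ℝ := fun a => A.indicator (fun _ => (1 : ℝ)) a - ν.real A with hg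
  have hgm : Measurable g := (measurable_const.indicator hA).sub_const _
  have hgb : ∀ a, |g a| ≤ 1 := fun a => by
    by_cases h : a ∈ A <;> simp only [hg, h, Set.indicator_of_mem, Set.indicator_of_notMem,
      not_false_eq_true] <;> rw [abs_le] <;> constructor <;> linarith
  have hind : ProbabilityTheory.iIndepFun (fun (i : Fin n) (z : Fin n → α) => g (z i))
      (Measure.pi fun _ : Fin n => ν) :=
    ProbabilityTheory.iIndepFun_pi fun _ => hgm.aemeasurable
  have hcomp : ∀ (i : Fin n) (f : α → ℝ), Measurable f →
      ∫ z, f (z i) ∂(Measure.pi fun _ : Fin n => ν) = ∫ a, f a ∂ν := fun i f hf => by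
    have := integral_map (μ := Measure.pi fun _ : Fin n => ν)
      (measurable_pi_apply i).aemeasurable hf.aestronglyMeasurable
    rw [← this]
    exact congrArg (fun m => ∫ a, f a ∂m) (measurePreserving_eval (fun _ : Fin n => ν) i).map_eq
  have hI : Integrable (A.indicator fun _ => (1 : ℝ)) ν := (integrable_const _).indicator hA
  have hAi : ∫ a, A.indicator (fun _ => (1 : ℝ)) a ∂ν = ν.real A := by
    rw [integral_indicator_const _ hA]; simp
  have := sum_moments_of_iIndepFun (v := ν.real A) hind (fun i => hgm.comp (measurable_pi_apply i))
    (fun i z => hgb (z i)) (fun i => by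
      rw [hcomp i g hgm]
      simp only [hg]
      rw [integral_sub hI (integrable_const _), hAi]; simp)
    (fun i => by
      rw [hcomp i (fun a => g a ^ 2) (hgm.pow_const 2)]
      have : ∀ a, g a ^ 2 = (1 - 2 * ν.real A) * A.indicator (fun _ => (1 : ℝ)) a
          + ν.real A ^ 2 := fun a => by
        by_cases h : a ∈ A <;> simp [hg, h] ; ring
      simp only [this]
      rw [integral_add (hI.const_mul _) (integrable_const _), integral_const_mul, hAi]
      simp only [integral_const, probReal_univ, smul_eq_mul, one_mul]
      nlinarith) Finset.univ
  simp only [Finset.card_univ, Fintype.card_fin] at this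
  exact this.2

/-- Chebyshev's inequality for the number of sample points in `A`. -/
lemma measure_countDeviation_ge_le [IsProbabilityMeasure ν] {A : Set α} (hA : MeasurableSet A)
    {t : ℝ} (ht : 0 < t) :
    (Measure.pi fun _ : Fin n => ν).real {z | t ≤ |countDeviation ν A z|}
      ≤ n * ν.real A / t ^ 2 := by
  rw [le_div_iff₀ (by positivity), mul_comm]
  refine le_trans ?_ (countDeviation_moments hA).1
  refine le_trans (mul_le_mul_of_nonneg_left (measureReal_mono ?_) (by positivity))
    (mul_meas_ge_le_integral_of_nonneg (Filter.Eventually.of_forall fun z => by positivity)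
      (integrable_of_abs_le ((measurable_countDeviation hA).pow_const 2) (B := (n : ℝ) ^ 2) ?_)
      (t ^ 2))
  · intro z hz
    show t ^ 2 ≤ countDeviation ν A z ^ 2
    rw [← sq_abs (countDeviation ν A z)]
    exact pow_le_pow_left₀ ht.le hz 2
  · intro z
    rw [abs_pow]
    exact pow_le_pow_left₀ (abs_nonneg _) (abs_countDeviation_le A z) 2

/-- Markov's inequality for the fourth moment of the number of sample points in `A`. -/
lemma measure_countDeviation_ge_le_four [IsProbabilityMeasure ν] {A : Set α}
    (hA : MeasurableSet A) {t : ℝ} (ht : 0 < t) :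
    (Measure.pi fun _ : Fin n => ν).real {z | t ≤ |countDeviation ν A z|}
      ≤ (n * ν.real A + 3 * (n * ν.real A) ^ 2) / t ^ 4 := by
  rw [le_div_iff₀ (by positivity), mul_comm]
  refine le_trans ?_ (countDeviation_moments hA).2
  refine le_trans (mul_le_mul_of_nonneg_left (measureReal_mono ?_) (by positivity))
    (mul_meas_ge_le_integral_of_nonneg (Filter.Eventually.of_forall fun z => by positivity)
      (integrable_of_abs_le ((measurable_countDeviation hA).pow_const 4) (B := (n : ℝ) ^ 4) ?_)
      (t ^ 4))
  · intro z hz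
    show t ^ 4 ≤ countDeviation ν A z ^ 4
    rw [← Even.pow_abs (by decide : Even 4) (countDeviation ν A z)]
    exact pow_le_pow_left₀ ht.le hz 4
  · intro z
    rw [abs_pow]
    exact pow_le_pow_left₀ (abs_nonneg _) (abs_countDeviation_le A z) 4

end countDeviation

/-! ### Dyadic chaining and the maximal inequality -/

lemma geom_sum_le_inv {r : ℝ} (h0 : 0 ≤ r) (h1 : r < 1) (m : ℕ) :
    ∑ i ∈ Finset.range m, r ^ i ≤ (1 - r)⁻¹ := by
  have h2 := geom_sum_mul_neg r m
  have h3 : 0 ≤ r ^ m := by positivity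
  rw [← one_div, le_div_iff₀ (by linarith)]
  linarith

/-- Dyadic chaining: the values of a function on a dyadic grid are bounded by the sum over the
levels of the largest increments. -/
lemma abs_le_sum_of_dyadic_increments {G : ℝ → ℝ} (hG : G 0 = 0) {H : ℝ} {t : ℕ → ℝ} {m : ℕ}
    (ht : ∀ l, 0 ≤ t l)
    (h : ∀ l ≤ m, ∀ j < 2 ^ l, |G (H * ((j : ℕ) + 1) / 2 ^ l) - G (H * (j : ℕ) / 2 ^ l)| ≤ t l) :
    ∀ l ≤ m, ∀ j ≤ 2 ^ l, |G (H * (j : ℕ) / 2 ^ l)| ≤ ∑ i ∈ Finset.range (l + 1), t i := by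
  intro l
  induction l with
  | zero =>
    intro hl j hj
    have h0 := h 0 hl 0 (by norm_num)
    rw [pow_zero] at hj
    interval_cases j
    · simpa [hG] using ht 0
    · simpa [hG] using h0
  | succ l ih =>
    intro hl j hj
    rw [Finset.sum_range_succ]
    have heven : ∀ j' : ℕ, j' ≤ 2 ^ l →
        |G (H * ((2 * j' : ℕ) : ℝ) / 2 ^ (l + 1))| ≤ ∑ i ∈ Finset.range (l + 1), t i := by
      intro j' hj'
      convert ih (by omega) j' hj' using 3
      push_cast
      rw [pow_succ]; field_simp
    rw [pow_succ] at hj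
    -- Even points already lie on the coarser grid; an odd point is one increment away from its even
    -- left neighbour.
    obtain ⟨j', rfl | rfl⟩ := Nat.even_or_odd' j
    · exact (heven j' (by omega)).trans (le_add_of_nonneg_right (ht _))
    · have h1 := heven j' (by omega)
      have h2 := h (l + 1) hl (2 * j') (by rw [pow_succ]; omega)
      have h3 : H * ((2 * j' + 1 : ℕ) : ℝ) / 2 ^ (l + 1)
        = H * (((2 * j' : ℕ) : ℝ) + 1) / 2 ^ (l + 1) := by push_cast; rfl
      rw [h3]
      have := abs_add_le (G (H * (((2 * j' : ℕ) : ℝ)) / 2 ^ (l + 1)))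
        (G (H * (((2 * j' : ℕ) : ℝ) + 1) / 2 ^ (l + 1)) - G (H * (((2 * j' : ℕ) : ℝ)) / 2 ^ (l + 1)))
      rw [add_sub_cancel] at this
      linarith

lemma countDeviation_sub {α : Type*} [MeasurableSpace α] {n : ℕ} {ν : Measure α}
    [IsFiniteMeasure ν] {A B : Set α} (hA : MeasurableSet A) (hAB : A ⊆ B)
    (z : Fin n → α) :
    countDeviation ν B z - countDeviation ν A z = countDeviation ν (B \ A) z := by
  unfold countDeviation
  rw [← Finset.sum_sub_distrib]
  refine Finset.sum_congr rfl fun i _ => ?_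
  rw [measureReal_sdiff hAB hA, Set.indicator_sdiff hAB]
  simp only [Pi.sub_apply]
  ring

lemma countDeviation_empty {α : Type*} [MeasurableSpace α] {n : ℕ} {ν : Measure α}
    (z : Fin n → α) : countDeviation ν ∅ z = 0 := by
  simp [countDeviation]

/-- Counts are nonnegative, so a deviation can fall only as far as the centring. This one-sided
bound is what controls the process between grid points. -/
lemma countDeviation_ge {α : Type*} [MeasurableSpace α] {n : ℕ} {ν : Measure α} (A : Set α)
    (z : Fin n → α) : -(n * ν.real A) ≤ countDeviation ν A z := by
  have : ∑ _i : Fin n, -ν.real A ≤ countDeviation ν A z := by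
    refine Finset.sum_le_sum fun i _ => ?_
    have : 0 ≤ A.indicator (fun _ => (1 : ℝ)) (z i) :=
      Set.indicator_nonneg (fun _ _ => zero_le_one) _
    linarith
  simpa using this

/-- A maximal inequality for the empirical process indexed by an increasing family of sets. -/
theorem exists_tail_bound_monotone_family {ρ τ : ℝ} (hρ : 0 < ρ) (hτ : 0 < τ) :
    ∃ C : ℝ, 0 < C ∧ ∀ {α : Type} [MeasurableSpace α] {ν : Measure α} [IsProbabilityMeasure ν]
      {n : ℕ} {A : ℝ → Set α} {lam η : ℝ}, (∀ u, MeasurableSet (A u)) → Monotone A → A 0 = ∅ →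
      (∀ u u', 0 ≤ u → u ≤ u' → n * ν.real (A u' \ A u) ≤ ρ * lam * (u' - u)) →
      0 < η → η ≤ 1 → 1 ≤ lam * η ^ 3 →
      (Measure.pi fun _ : Fin n => ν).real
        {z | ∃ u ∈ Set.Icc 0 (2 * η), τ * lam * η ^ 2 < |countDeviation ν (A u) z|}
        ≤ C / (lam * η ^ 3) := by
  -- A lower bound for `V l` at every level used. It turns the linear part of the fourth-moment
  -- bound into a quadratic one, since `V ≤ V ^ 2 / κ`.
  set κ : ℝ := ρ * τ / (τ + 4 * ρ) with hκ
  have hκ0 : 0 < κ := by positivity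
  set C₁ : ℝ := (1 / κ + 3) * (4 * ρ ^ 2) * (20 / τ) ^ 4 with hC₁
  have hC₁0 : 0 < C₁ := by positivity
  refine ⟨C₁ * 5, by positivity, ?_⟩
  intro α _ ν _ n A lam η hA hmono hA0 hν hη hη1 hlam
  have hlam0 : 0 < lam := pos_of_mul_pos_left (by linarith : 0 < lam * η ^ 3) (by positivity)
  have hlamη : 1 ≤ lam * η ^ 2 := by
    refine hlam.trans ?_
    have : η ^ 3 ≤ η ^ 2 := pow_le_pow_of_le_one hη.le hη1 (by norm_num)
    exact mul_le_mul_of_nonneg_left this hlam0.le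
  -- The depth `m` makes `2 ^ m` comparable to `1 + 4ρ/(τη)`: large enough that a finest cell has
  -- expected count at most half the threshold, small enough that `V m` stays above `κ`.
  obtain ⟨k, hk1, hk2⟩ := exists_nat_pow_near (x := 1 + 4 * ρ / (τ * η)) (y := (2 : ℝ))
    (by have : 0 ≤ 4 * ρ / (τ * η) := by positivity
        linarith) (by norm_num)
  set m := k + 1 with hm
  have hm1 : 4 * ρ / (τ * η) ≤ 2 ^ m := by linarith
  have hm2 : (2 : ℝ) ^ m ≤ 2 * (1 + 4 * ρ / (τ * η)) := by rw [hm, pow_succ]; linarith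
  set G : (Fin n → α) → ℝ → ℝ := fun z u => countDeviation ν (A u) z with hG
  -- The thresholds sum to at most `τ/2 * lam * η ^ 2`. The ratio `9/10` is slow enough that the
  -- level probabilities still decay: `2 * (1/4) * (10/9) ^ 4 = 5000/6561 < 1`.
  set t : ℕ → ℝ := fun l => τ / 20 * (lam * η ^ 2) * (9 / 10) ^ l with ht
  have ht0 : ∀ l, 0 < t l := fun l => by positivity
  set P : ℕ → ℕ → ℝ := fun l j => 2 * η * (j : ℕ) / 2 ^ l with hP
  set V : ℕ → ℝ := fun l => 2 * ρ * lam * η / 2 ^ l with hV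
  have hV0 : ∀ l, 0 < V l := fun l => by positivity
  have hPs : ∀ l j : ℕ, P l (j + 1) = P l j + 2 * η / 2 ^ l := fun l j => by
    simp only [hP]; push_cast; ring
  have hPle : ∀ l j : ℕ, P l j ≤ P l (j + 1) := fun l j => by
    rw [hPs]; have : 0 ≤ 2 * η / 2 ^ l := by positivity
    linarith
  have hP0 : ∀ l j : ℕ, 0 ≤ P l j := fun l j => by positivity
  set E : ℕ → ℕ → Set (Fin n → α) := fun l j =>
    {z | t l ≤ |countDeviation ν (A (P l (j + 1)) \ A (P l j)) z|} with hE
  -- The probability of a large increment over a dyadic cell.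
  have hEbound : ∀ l ≤ m, ∀ j : ℕ, (Measure.pi fun _ : Fin n => ν).real (E l j)
      ≤ (1 / κ + 3) * V l ^ 2 / t l ^ 4 := by
    intro l hl j
    refine (measure_countDeviation_ge_le_four ((hA _).diff (hA _)) (ht0 l)).trans ?_
    refine div_le_div_of_nonneg_right ?_ (by have := ht0 l; positivity)
    have hv0 : 0 ≤ n * ν.real (A (P l (j + 1)) \ A (P l j)) := by positivity
    have hvV : n * ν.real (A (P l (j + 1)) \ A (P l j)) ≤ V l := by
      refine (hν _ _ (hP0 l j) (hPle l j)).trans (le_of_eq ?_)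
      rw [hPs]; simp only [hV]; ring
    have hκV : κ ≤ V l := by
      have h1 : V m ≤ V l := by
        simp only [hV]
        exact div_le_div_of_nonneg_left (by positivity) (by positivity)
          (pow_le_pow_right₀ (by norm_num) hl)
      refine le_trans ?_ h1
      simp only [hV]
      rw [le_div_iff₀ (by positivity)]
      have h2 : κ * 2 ^ m ≤ κ * (2 * (1 + 4 * ρ / (τ * η))) :=
        mul_le_mul_of_nonneg_left hm2 hκ0.le
      refine h2.trans ?_
      have h3 : κ * (2 * (1 + 4 * ρ / (τ * η))) * η ≤ 2 * ρ := by
        have : κ * (2 * (1 + 4 * ρ / (τ * η))) * η = 2 * ρ * ((τ * η + 4 * ρ) / (τ + 4 * ρ)) := by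
          rw [hκ]; field_simp
        rw [this]
        refine mul_le_of_le_one_right (by positivity) ?_
        rw [div_le_one (by positivity)]
        nlinarith
      have h4 : κ * (2 * (1 + 4 * ρ / (τ * η))) ≤ 2 * ρ / η := by
        rwa [le_div_iff₀ hη]
      refine h4.trans ?_
      rw [div_le_iff₀ hη]
      nlinarith
    have hVsq : V l ≤ 1 / κ * V l ^ 2 := by
      rw [one_div, ← div_eq_inv_mul, le_div_iff₀ hκ0, sq]
      exact mul_le_mul_of_nonneg_left hκV (hV0 l).le
    have : (n * ν.real (A (P l (j + 1)) \ A (P l j))) ^ 2 ≤ V l ^ 2 := pow_le_pow_left₀ hv0 hvV 2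
    nlinarith
  -- Off the union of these events the deviation is small on the whole interval.
  have hsub : {z | ∃ u ∈ Set.Icc 0 (2 * η), τ * lam * η ^ 2 < |countDeviation ν (A u) z|}
      ⊆ ⋃ l ∈ Finset.range (m + 1), ⋃ j ∈ Finset.range (2 ^ l), E l j := by
    intro z hz
    by_contra hcon
    simp only [Set.mem_iUnion, Finset.mem_range, not_exists, hE, Set.mem_ofPred_eq, not_le] at hcon
    obtain ⟨u, ⟨hu0, hu1⟩, hu⟩ := hz
    have hinc : ∀ l ≤ m, ∀ j < 2 ^ l,
        |G z (2 * η * ((j : ℕ) + 1) / 2 ^ l) - G z (2 * η * (j : ℕ) / 2 ^ l)| ≤ t l := by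
      intro l hl j hj
      have h1 := hcon l (by omega) j hj
      rw [← countDeviation_sub (hA _) (hmono (hPle l j))] at h1
      have h2 : 2 * η * ((j : ℕ) + 1) / 2 ^ l = P l (j + 1) := by simp only [hP]; push_cast; rfl
      rw [h2]
      exact h1.le
    have hgrid : ∀ j ≤ 2 ^ m, |G z (P m j)| ≤ τ / 2 * lam * η ^ 2 := by
      intro j hj
      refine (abs_le_sum_of_dyadic_increments (G := G z) (by simp [hG, hA0, countDeviation_empty])
        (fun l => (ht0 l).le) hinc m le_rfl j hj).trans ?_
      simp only [ht]
      rw [← Finset.mul_sum]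
      have : ∑ i ∈ Finset.range (m + 1), (9 / 10 : ℝ) ^ i ≤ 10 := by
        exact (geom_sum_le_inv (by norm_num) (by norm_num) _).trans (by norm_num)
      calc _ ≤ τ / 20 * (lam * η ^ 2) * 10 := mul_le_mul_of_nonneg_left this (by positivity)
        _ = _ := by ring
    have hcell : ρ * lam * (2 * η / 2 ^ m) ≤ τ / 2 * lam * η ^ 2 := by
      rw [← mul_div_assoc, div_le_iff₀ (by positivity)]
      rw [div_le_iff₀ (by positivity)] at hm1
      nlinarith [mul_le_mul_of_nonneg_left hm1 (by positivity : 0 ≤ lam * η / 2)]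
    rcases eq_or_lt_of_le hu1 with rfl | hu1
    · have := hgrid (2 ^ m) le_rfl
      have h2 : P m (2 ^ m) = 2 * η := by simp [hP]
      rw [h2] at this
      have h3 : 0 < τ * lam * η ^ 2 := by positivity
      simp only [hG] at this
      linarith
    · set j := ⌊u * 2 ^ m / (2 * η)⌋₊ with hj
      have hj1 : (j : ℝ) ≤ u * 2 ^ m / (2 * η) := Nat.floor_le (by positivity)
      have hj2 : u * 2 ^ m / (2 * η) < j + 1 := Nat.lt_floor_add_one _
      have hjm : j < 2 ^ m := by
        have : (j : ℝ) < 2 ^ m := by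
          refine hj1.trans_lt ?_
          rw [div_lt_iff₀ (by positivity), mul_comm]
          exact mul_lt_mul_of_pos_left hu1 (by positivity)
        exact_mod_cast this
      have hl : P m j ≤ u := by
        simp only [hP]
        rw [le_div_iff₀ (by positivity)] at hj1
        rw [div_le_iff₀ (by positivity)]; linarith
      have hr : u ≤ P m (j + 1) := by
        simp only [hP]
        rw [div_lt_iff₀ (by positivity)] at hj2
        rw [le_div_iff₀ (by positivity)]; push_cast; linarith
      have g1 := abs_le.mp (hgrid j hjm.le)
      have g2 := abs_le.mp (hgrid (j + 1) hjm)
      -- The family is monotone, so `u` is squeezed between two grid points: enlarging a set lowers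
      -- the centred count by at most the expected count of the added part, which `hcell` bounds.
      have c1 := countDeviation_sub (ν := ν) (hA _) (hmono hl) z
      have c2 := countDeviation_sub (ν := ν) (hA _) (hmono hr) z
      have d1 := countDeviation_ge (ν := ν) (A u \ A (P m j)) z
      have d2 := countDeviation_ge (ν := ν) (A (P m (j + 1)) \ A u) z
      have e1 := hν _ _ (hP0 m j) hl
      have e2 := hν _ _ hu0 hr
      have f1 : ρ * lam * (u - P m j) ≤ ρ * lam * (2 * η / 2 ^ m) :=
        mul_le_mul_of_nonneg_left (by rw [hPs] at hr; linarith) (by positivity)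
      have f2 : ρ * lam * (P m (j + 1) - u) ≤ ρ * lam * (2 * η / 2 ^ m) :=
        mul_le_mul_of_nonneg_left (by rw [hPs]; linarith) (by positivity)
      simp only [hG] at g1 g2
      refine absurd hu (not_lt.mpr (abs_le.mpr ⟨?_, ?_⟩)) <;> linarith
  -- Summing the probabilities.
  refine (measureReal_mono hsub (measure_ne_top _ _)).trans ?_
  refine (measureReal_biUnion_finset_le _ _).trans ?_
  have hlevel : ∀ l ∈ Finset.range (m + 1),
      (Measure.pi fun _ : Fin n => ν).real (⋃ j ∈ Finset.range (2 ^ l), E l j)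
        ≤ C₁ / (lam * η ^ 3) * (5000 / 6561) ^ l := by
    intro l hl
    refine (measureReal_biUnion_finset_le _ _).trans ?_
    refine (Finset.sum_le_sum fun j _ => hEbound l (by simpa [Nat.lt_succ_iff] using hl) j).trans ?_
    rw [Finset.sum_const, Finset.card_range, nsmul_eq_mul]
    have h1 : ((2 ^ l : ℕ) : ℝ) * ((1 / κ + 3) * V l ^ 2 / t l ^ 4)
        = C₁ / (lam * η ^ 3) ^ 2 * (5000 / 6561) ^ l := by
      have e1 : ((5000 : ℝ) / 6561) ^ l * ((9 / 10) ^ l) ^ 4 * 2 ^ l = 1 := by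
        rw [← pow_mul, mul_comm l 4, pow_mul, ← mul_pow, ← mul_pow]; norm_num
      simp only [hV, ht, hC₁]
      push_cast
      have h9 : ((9 : ℝ) / 10) ^ l ≠ 0 := by positivity
      generalize (9 / 10 : ℝ) ^ l = x at *
      generalize (5000 / 6561 : ℝ) ^ l = y at *
      have h2 : (2 : ℝ) ^ l ≠ 0 := by positivity
      generalize (2 : ℝ) ^ l = w at *
      have hy : y = 1 / (x ^ 4 * w) := by
        field_simp; linarith
      rw [hy]
      field_simp
      norm_num
    rw [h1]
    -- The fourth moment gives the square of `1 / (lam * η ^ 3)`; as `lam * η ^ 3 ≥ 1`, the first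
    -- power is a weaker bound, and it is all that peeling needs.
    refine mul_le_mul_of_nonneg_right ?_ (by positivity)
    refine div_le_div_of_nonneg_left hC₁0.le (by linarith) ?_
    nlinarith
  refine (Finset.sum_le_sum hlevel).trans ?_
  rw [← Finset.mul_sum, show C₁ * 5 / (lam * η ^ 3) = C₁ / (lam * η ^ 3) * 5 by ring]
  refine mul_le_mul_of_nonneg_left ?_ (by positivity)
  exact (geom_sum_le_inv (by norm_num) (by norm_num) _).trans (by norm_num)

/-! ### Peeling over dyadic shells -/

/-- Peeling: a cubic tail bound above the scale `η₀` bounds the second moment by `η₀ ^ 2`. -/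
lemma integral_sq_le_of_shell_bound {Ω : Type*} [MeasurableSpace Ω] {μ : Measure Ω}
    [IsProbabilityMeasure μ] {D : Ω → ℝ} (hD : Measurable D) (hD0 : ∀ ω, 0 ≤ D ω)
    (hD1 : ∀ ω, D ω ≤ 1) {C lam η₀ : ℝ} (hC : 0 < C) (hη₀ : 0 < η₀) (hlam : 1 ≤ lam * η₀ ^ 3)
    (h : ∀ η, η₀ ≤ η → η ≤ 1 → μ.real {ω | η ≤ D ω ∧ D ω ≤ 2 * η} ≤ C / (lam * η ^ 3)) :
    ∫ ω, D ω ^ 2 ∂μ ≤ η₀ ^ 2 * (1 + 8 * C) := by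
  have hlam0 : 0 < lam := pos_of_mul_pos_left (by linarith : 0 < lam * η₀ ^ 3) (by positivity)
  -- Finitely many shells suffice: `2 ^ J * η₀` exceeds one, the largest value of `D`.
  obtain ⟨J, hJ⟩ := pow_unbounded_of_one_lt (1 / η₀) (by norm_num : (1 : ℝ) < 2)
  set S : ℕ → Set Ω := fun j => {ω | 2 ^ j * η₀ ≤ D ω ∧ D ω ≤ 2 * (2 ^ j * η₀)} with hS
  have hSm : ∀ j, MeasurableSet (S j) := fun j =>
    (measurableSet_le measurable_const hD).inter (measurableSet_le hD measurable_const)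
  have hpt : ∀ ω, D ω ^ 2 ≤ η₀ ^ 2 + ∑ j ∈ Finset.range J,
      4 * (2 ^ j * η₀) ^ 2 * (S j).indicator (fun _ => (1 : ℝ)) ω := by
    intro ω
    have hnn : ∀ j ∈ Finset.range J,
        0 ≤ 4 * (2 ^ j * η₀) ^ 2 * (S j).indicator (fun _ => (1 : ℝ)) ω := fun j _ =>
      mul_nonneg (by positivity) (Set.indicator_nonneg (fun _ _ => zero_le_one) _)
    rcases le_or_gt (D ω) η₀ with hle | hgt
    · have := Finset.sum_nonneg hnn
      have := pow_le_pow_left₀ (hD0 ω) hle 2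
      linarith
    · obtain ⟨j, hj1, hj2⟩ := exists_nat_pow_near (x := D ω / η₀) (y := (2 : ℝ))
        (by rw [le_div_iff₀ hη₀]; linarith) (by norm_num)
      rw [le_div_iff₀ hη₀] at hj1
      rw [div_lt_iff₀ hη₀, pow_succ] at hj2
      have hjJ : j < J := by
        by_contra hcon
        have h1 : (2 : ℝ) ^ J ≤ 2 ^ j := pow_le_pow_right₀ (by norm_num) (not_lt.mp hcon)
        rw [div_lt_iff₀ hη₀] at hJ
        have := hD1 ω
        nlinarith
      have hmem : ω ∈ S j := ⟨hj1, by linarith⟩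
      have h1 := Finset.single_le_sum hnn (Finset.mem_range.mpr hjJ)
      rw [Set.indicator_of_mem hmem, mul_one] at h1
      have h2 : D ω ^ 2 ≤ (2 * (2 ^ j * η₀)) ^ 2 := pow_le_pow_left₀ (hD0 ω) hmem.2 2
      nlinarith [sq_nonneg η₀]
  have hint : ∀ j ∈ Finset.range J, Integrable
      (fun ω => 4 * (2 ^ j * η₀) ^ 2 * (S j).indicator (fun _ => (1 : ℝ)) ω) μ := fun j _ =>
    ((integrable_const _).indicator (hSm j)).const_mul _
  have hDint : Integrable (fun ω => D ω ^ 2) μ :=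
    integrable_of_abs_le (hD.pow_const 2) (B := 1) fun ω => by
      rw [abs_pow, abs_of_nonneg (hD0 ω)]; exact pow_le_one₀ (hD0 ω) (hD1 ω)
  refine (integral_mono hDint ((integrable_const _).fun_add (integrable_finsetSum _ hint))
    hpt).trans ?_
  rw [integral_add (integrable_const _) (integrable_finsetSum _ hint), integral_finsetSum _ hint]
  simp only [integral_const, probReal_univ, smul_eq_mul, one_mul]
  have hterm : ∀ j ∈ Finset.range J,
      ∫ ω, 4 * (2 ^ j * η₀) ^ 2 * (S j).indicator (fun _ => (1 : ℝ)) ω ∂μ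
        ≤ 4 * C * η₀ ^ 2 * (1 / 2) ^ j := by
    intro j _
    rw [integral_const_mul, integral_indicator_const _ (hSm j), smul_eq_mul, mul_one]
    have hpos : 0 < 2 ^ j * η₀ := by positivity
    have hle : η₀ ≤ 2 ^ j * η₀ := le_mul_of_one_le_left hη₀.le (one_le_pow₀ (by norm_num))
    have hprob : μ.real (S j) ≤ C / (lam * (2 ^ j * η₀) ^ 3) := by
      rcases le_or_gt (2 ^ j * η₀) 1 with h1 | h1
      · exact h _ hle h1
      · have : S j = ∅ := by
          ext ω; simp only [hS, Set.mem_ofPred_eq, Set.mem_empty_iff_false, iff_false]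
          intro hω; linarith [hD1 ω, hω.1]
        rw [this, measureReal_empty]; positivity
    -- The square contributes `4 ^ j` and the cubic tail `8 ^ (-j)`, leaving a convergent geometric
    -- series.
    calc 4 * (2 ^ j * η₀) ^ 2 * μ.real (S j)
        ≤ 4 * (2 ^ j * η₀) ^ 2 * (C / (lam * (2 ^ j * η₀) ^ 3)) :=
          mul_le_mul_of_nonneg_left hprob (by positivity)
      _ = 4 * C * η₀ ^ 2 * (1 / 2) ^ j / (lam * η₀ ^ 3) := by
          rw [div_pow, one_pow]; field_simp
      _ ≤ 4 * C * η₀ ^ 2 * (1 / 2) ^ j := div_le_self (by positivity) hlam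
  have hgeo : ∑ j ∈ Finset.range J, (1 / 2 : ℝ) ^ j ≤ 2 := by
    exact (geom_sum_le_inv (by norm_num) (by norm_num) _).trans (by norm_num)
  have := Finset.sum_le_sum hterm
  rw [← Finset.mul_sum] at this
  have h3 : 4 * C * η₀ ^ 2 * ∑ j ∈ Finset.range J, (1 / 2 : ℝ) ^ j ≤ 4 * C * η₀ ^ 2 * 2 :=
    mul_le_mul_of_nonneg_left hgeo (by positivity)
  linarith

/-! ### Quadratic bounds for the revenue in the price -/

/-- If the derivative of `h` points towards `a` at least linearly with rate `c`, then `h` lies below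
a parabola with vertex at `a`. -/
lemma le_sub_sq_of_hasDerivAt {h g : ℝ → ℝ} {a c : ℝ} (ha : a ∈ Set.Icc (0 : ℝ) 1)
    (hc : ContinuousOn h (Set.Icc 0 1)) (hd : ∀ y ∈ Set.Ioo (0 : ℝ) 1, HasDerivAt h (g y) y)
    (hg : ∀ y ∈ Set.Ioo (0 : ℝ) 1, g y * (y - a) ≤ -c * (y - a) ^ 2)
    {p : ℝ} (hp : p ∈ Set.Icc (0 : ℝ) 1) : h p ≤ h a - c / 2 * (p - a) ^ 2 := by
  -- After adding the parabola the derivative still points weakly towards `a`, so `k` is maximal at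
  -- `a`.
  set k : ℝ → ℝ := fun y => h y + c / 2 * (y - a) ^ 2 with hk
  have hkc : ContinuousOn k (Set.Icc 0 1) := hc.add (by fun_prop)
  have hkd : ∀ y ∈ Set.Ioo (0 : ℝ) 1, HasDerivAt k (g y + c * (y - a)) y := fun y hy => by
    have h1 : HasDerivAt (fun y : ℝ => c / 2 * (y - a) ^ 2) (c * (y - a)) y := by
      have := (((hasDerivAt_id y).sub_const a).pow 2).const_mul (c / 2)
      refine this.congr_deriv ?_
      push_cast
      simp only [id_eq]
      ring
    exact (hd y hy).add h1
  have hsign : ∀ y ∈ Set.Ioo (0 : ℝ) 1, (g y + c * (y - a)) * (y - a) ≤ 0 := fun y hy => by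
    nlinarith [hg y hy]
  suffices k p ≤ k a by
    simp only [hk] at this
    nlinarith
  rcases le_total a p with hap | hap
  · have : AntitoneOn k (Set.Icc a 1) := by
      refine antitoneOn_of_deriv_nonpos (convex_Icc _ _)
        (hkc.mono (Set.Icc_subset_Icc_left ha.1)) ?_ ?_ <;> rw [interior_Icc]
      · intro y hy
        exact (hkd y ⟨ha.1.trans_lt hy.1, hy.2⟩).differentiableAt.differentiableWithinAt
      · intro y hy
        have hy' : y ∈ Set.Ioo (0 : ℝ) 1 := ⟨ha.1.trans_lt hy.1, hy.2⟩
        rw [(hkd y hy').deriv]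
        by_contra hcon
        exact absurd (hsign y hy') (not_le.mpr (mul_pos (not_le.mp hcon) (sub_pos.mpr hy.1)))
    exact this ⟨le_rfl, ha.2⟩ ⟨hap, hp.2⟩ hap
  · have : MonotoneOn k (Set.Icc 0 a) := by
      refine monotoneOn_of_deriv_nonneg (convex_Icc _ _)
        (hkc.mono (Set.Icc_subset_Icc_right ha.2)) ?_ ?_ <;> rw [interior_Icc]
      · intro y hy
        exact (hkd y ⟨hy.1, hy.2.trans_le ha.2⟩).differentiableAt.differentiableWithinAt
      · intro y hy
        have hy' : y ∈ Set.Ioo (0 : ℝ) 1 := ⟨hy.1, hy.2.trans_le ha.2⟩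
        rw [(hkd y hy').deriv]
        by_contra hcon
        exact absurd (hsign y hy')
          (not_le.mpr (mul_pos_of_neg_of_neg (not_le.mp hcon) (sub_neg.mpr hy.2)))
    exact this ⟨hp.1, hap⟩ ⟨ha.1, le_rfl⟩ hap

namespace JointModel

/-- The derivative of the revenue in the price. -/
noncomputable def marginalRevenue (M : JointModel) (y x : ℝ) : ℝ :=
  1 - M.condCDF y x - y * M.condDensity y x

variable {M : JointModel} {C₀ Cs Cb Cu Cl : ℝ}

lemma InClass.continuousOn_condDensity (hM : M.InClass C₀ Cs Cb Cu Cl) {x : ℝ}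
    (hx : x ∈ Set.Icc (0 : ℝ) 1) : ContinuousOn (fun y => M.condDensity y x) (Set.Icc 0 1) := by
  refine LipschitzOnWith.continuousOn (K := C₀.toNNReal) (LipschitzOnWith.of_dist_le_mul
    fun y hy y' hy' => ?_)
  rw [Real.dist_eq, Real.dist_eq]
  exact (hM.lipschitz x hx y hy y' hy').trans
    (mul_le_mul_of_nonneg_right (Real.le_coe_toNNReal _) (abs_nonneg _))

lemma InClass.intervalIntegrable_condDensity (hM : M.InClass C₀ Cs Cb Cu Cl) {x a b : ℝ}
    (hx : x ∈ Set.Icc (0 : ℝ) 1) (ha : a ∈ Set.Icc (0 : ℝ) 1) (hb : b ∈ Set.Icc (0 : ℝ) 1) :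
    IntervalIntegrable (fun y => M.condDensity y x) volume a b :=
  ((hM.continuousOn_condDensity hx).mono (Set.uIcc_subset_Icc ha hb)).intervalIntegrable

/-- The density integrates to one and varies by at most `C₀` on the unit interval, so it cannot
exceed its mean by more than `C₀`. -/
lemma InClass.condDensity_le (hM : M.InClass C₀ Cs Cb Cu Cl) (hC₀ : 0 ≤ C₀) {x y : ℝ}
    (hx : x ∈ Set.Icc (0 : ℝ) 1) (hy : y ∈ Set.Icc (0 : ℝ) 1) : M.condDensity y x ≤ 1 + C₀ := by
  have h0 : (0 : ℝ) ∈ Set.Icc (0 : ℝ) 1 := by simp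
  have h1 : (1 : ℝ) ∈ Set.Icc (0 : ℝ) 1 := by simp
  have : ∫ t in (0 : ℝ)..1, (M.condDensity y x - C₀) ≤ ∫ t in (0 : ℝ)..1, M.condDensity t x := by
    refine intervalIntegral.integral_mono_on zero_le_one intervalIntegrable_const
      (hM.intervalIntegrable_condDensity hx h0 h1) fun t ht => ?_
    have h2 := (abs_le.mp (hM.lipschitz x hx y hy t ht)).2
    have h3 : |y - t| ≤ 1 := by rw [abs_le]; constructor <;> linarith [hy.1, hy.2, ht.1, ht.2]
    nlinarith
  rw [M.integral_condDensity x hx] at this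
  simp at this
  linarith

lemma InClass.condCDF_sub (hM : M.InClass C₀ Cs Cb Cu Cl) {x a b : ℝ}
    (hx : x ∈ Set.Icc (0 : ℝ) 1) (ha : a ∈ Set.Icc (0 : ℝ) 1) (hb : b ∈ Set.Icc (0 : ℝ) 1) :
    M.condCDF b x - M.condCDF a x = ∫ t in a..b, M.condDensity t x :=
  intervalIntegral.integral_interval_sub_left
    (hM.intervalIntegrable_condDensity hx (by simp) hb)
    (hM.intervalIntegrable_condDensity hx (by simp) ha)

lemma InClass.abs_condCDF_sub_le (hM : M.InClass C₀ Cs Cb Cu Cl) (hC₀ : 0 ≤ C₀) {x a b : ℝ}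
    (hx : x ∈ Set.Icc (0 : ℝ) 1) (ha : a ∈ Set.Icc (0 : ℝ) 1) (hb : b ∈ Set.Icc (0 : ℝ) 1) :
    |M.condCDF b x - M.condCDF a x| ≤ (1 + C₀) * |b - a| := by
  rw [hM.condCDF_sub hx ha hb, ← Real.norm_eq_abs]
  refine intervalIntegral.norm_integral_le_of_norm_le_const fun t ht => ?_
  have ht' : t ∈ Set.Icc (0 : ℝ) 1 := Set.uIcc_subset_Icc ha hb (Set.uIoc_subset_uIcc ht)
  rw [Real.norm_eq_abs, abs_of_nonneg (M.condDensity_nonneg t ht' x hx)]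
  exact hM.condDensity_le hC₀ hx ht'

lemma InClass.condCDF_mem_Icc (hM : M.InClass C₀ Cs Cb Cu Cl) {x y : ℝ}
    (hx : x ∈ Set.Icc (0 : ℝ) 1) (hy : y ∈ Set.Icc (0 : ℝ) 1) :
    M.condCDF y x ∈ Set.Icc (0 : ℝ) 1 := by
  constructor
  · exact intervalIntegral.integral_nonneg hy.1 fun t ht =>
      M.condDensity_nonneg t ⟨ht.1, ht.2.trans hy.2⟩ x hx
  · have h1 : M.condCDF 1 x = 1 := M.integral_condDensity x hx
    have h2 := hM.condCDF_sub hx hy (by simp : (1 : ℝ) ∈ Set.Icc (0 : ℝ) 1)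
    have h3 : 0 ≤ ∫ t in y..1, M.condDensity t x :=
      intervalIntegral.integral_nonneg hy.2 fun t ht =>
        M.condDensity_nonneg t ⟨hy.1.trans ht.1, ht.2⟩ x hx
    linarith

lemma InClass.hasDerivAt_condCDF (hM : M.InClass C₀ Cs Cb Cu Cl) {x y : ℝ}
    (hx : x ∈ Set.Icc (0 : ℝ) 1) (hy : y ∈ Set.Ioo (0 : ℝ) 1) :
    HasDerivAt (fun y => M.condCDF y x) (M.condDensity y x) y := by
  have hc := hM.continuousOn_condDensity hx
  refine intervalIntegral.integral_hasDerivAt_right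
    (hM.intervalIntegrable_condDensity hx (by simp) ⟨hy.1.le, hy.2.le⟩) ?_
    (hc.continuousAt (Icc_mem_nhds hy.1 hy.2))
  exact (hc.mono Set.Ioo_subset_Icc_self).stronglyMeasurableAtFilter isOpen_Ioo y hy

lemma InClass.continuousOn_condCDF (hM : M.InClass C₀ Cs Cb Cu Cl) {x : ℝ}
    (hx : x ∈ Set.Icc (0 : ℝ) 1) : ContinuousOn (fun y => M.condCDF y x) (Set.Icc 0 1) := by
  have := intervalIntegral.continuousOn_primitive_interval' (μ := volume)
    (hM.intervalIntegrable_condDensity hx (by simp : (0 : ℝ) ∈ Set.Icc (0 : ℝ) 1)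
    (by simp : (1 : ℝ) ∈ Set.Icc (0 : ℝ) 1)) (a := 0) (by simp)
  rwa [Set.uIcc_of_le zero_le_one] at this

lemma InClass.continuousOn_revenue (hM : M.InClass C₀ Cs Cb Cu Cl) {x : ℝ}
    (hx : x ∈ Set.Icc (0 : ℝ) 1) : ContinuousOn (fun y => M.revenue y x) (Set.Icc 0 1) :=
  (continuousOn_const.sub (hM.continuousOn_condCDF hx)).mul continuousOn_id

lemma InClass.hasDerivAt_revenue (hM : M.InClass C₀ Cs Cb Cu Cl) {x y : ℝ}
    (hx : x ∈ Set.Icc (0 : ℝ) 1) (hy : y ∈ Set.Ioo (0 : ℝ) 1) :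
    HasDerivAt (fun y => M.revenue y x) (M.marginalRevenue y x) y := by
  have := ((hM.hasDerivAt_condCDF hx hy).const_sub 1).mul (hasDerivAt_id y)
  refine this.congr_deriv ?_
  unfold marginalRevenue
  simp only [id_eq]
  ring

lemma InClass.abs_marginalRevenue_sub_le (hM : M.InClass C₀ Cs Cb Cu Cl) (hC₀ : 0 ≤ C₀)
    {x y y' : ℝ} (hx : x ∈ Set.Icc (0 : ℝ) 1) (hy : y ∈ Set.Icc (0 : ℝ) 1)
    (hy' : y' ∈ Set.Icc (0 : ℝ) 1) :
    |M.marginalRevenue y x - M.marginalRevenue y' x| ≤ (2 + 3 * C₀) * |y - y'| := by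
  have e : M.marginalRevenue y x - M.marginalRevenue y' x
      = (M.condCDF y' x - M.condCDF y x) + ((y' - y) * M.condDensity y x
        + y' * (M.condDensity y' x - M.condDensity y x)) := by
    simp only [marginalRevenue]; ring
  rw [e, abs_sub_comm y y']
  have h1 := hM.abs_condCDF_sub_le hC₀ hx hy hy'
  have h2 : |(y' - y) * M.condDensity y x| ≤ |y' - y| * (1 + C₀) := by
    rw [abs_mul, abs_of_nonneg (M.condDensity_nonneg y hy x hx)]
    exact mul_le_mul_of_nonneg_left (hM.condDensity_le hC₀ hx hy) (abs_nonneg _)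
  have h3 : |y' * (M.condDensity y' x - M.condDensity y x)| ≤ 1 * (C₀ * |y' - y|) := by
    rw [abs_mul, abs_of_nonneg hy'.1]
    exact mul_le_mul hy'.2 (hM.lipschitz x hx y' hy' y hy) (abs_nonneg _) zero_le_one
  refine (abs_add_le _ _).trans ((add_le_add h1 ((abs_add_le _ _).trans (add_le_add h2 h3))).trans
    (le_of_eq (by ring)))

lemma InClass.marginalRevenue_optimal (hM : M.InClass C₀ Cs Cb Cu Cl) {x a : ℝ}
    (hx : x ∈ Set.Icc (0 : ℝ) 1) (ha : M.IsOptimalPrice x a) : M.marginalRevenue a x = 0 := by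
  have ha' := hM.interior x hx a ha
  have : IsLocalMax (fun y => M.revenue y x) a := by
    filter_upwards [Icc_mem_nhds ha'.1 ha'.2] with z hz using ha.2 z hz
  exact this.hasDerivAt_eq_zero (hM.hasDerivAt_revenue hx ha')

/-- The revenue loss is at most quadratic in the distance to the optimal price. -/
lemma InClass.revenue_optimal_sub_le (hM : M.InClass C₀ Cs Cb Cu Cl) (hC₀ : 0 ≤ C₀) {x a p : ℝ}
    (hx : x ∈ Set.Icc (0 : ℝ) 1) (ha : M.IsOptimalPrice x a) (hp : p ∈ Set.Icc (0 : ℝ) 1) :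
    M.revenue a x - M.revenue p x ≤ (2 + 3 * C₀) / 2 * (p - a) ^ 2 := by
  -- The parabola comparison applied to the negated revenue with a negative rate yields the opposite
  -- inequality.
  have := le_sub_sq_of_hasDerivAt (h := fun y => -M.revenue y x)
    (g := fun y => -M.marginalRevenue y x) (c := -(2 + 3 * C₀)) ha.1
    (hM.continuousOn_revenue hx).neg (fun y hy => (hM.hasDerivAt_revenue hx hy).neg)
    (fun y hy => ?_) hp
  · linarith
  · have h1 := hM.abs_marginalRevenue_sub_le hC₀ hx ⟨hy.1.le, hy.2.le⟩ ha.1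
    rw [hM.marginalRevenue_optimal hx ha, sub_zero] at h1
    have h2 : |-M.marginalRevenue y x * (y - a)| ≤ (2 + 3 * C₀) * |y - a| * |y - a| := by
      rw [abs_mul, abs_neg]
      exact mul_le_mul_of_nonneg_right h1 (abs_nonneg _)
    rw [mul_assoc, ← sq, sq_abs] at h2
    simpa using (le_abs_self _).trans h2

lemma ae_ae_of_ae_unitSquare {P : ℝ × ℝ → Prop}
    (h : ∀ᵐ z ∂(volume.restrict unitSquare : Measure (ℝ × ℝ)), P z) :
    ∀ᵐ x ∂(volume.restrict (Set.Icc (0 : ℝ) 1)), ∀ᵐ y ∂(volume.restrict (Set.Icc (0 : ℝ) 1)),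
      P (y, x) := by
  have e : (volume.restrict unitSquare : Measure (ℝ × ℝ))
      = (volume.restrict (Set.Icc (0 : ℝ) 1)).prod (volume.restrict (Set.Icc (0 : ℝ) 1)) := by
    rw [Measure.prod_restrict]; rfl
  rw [e, ← Measure.prod_swap] at h
  exact Measure.ae_ae_of_ae_prod (ae_of_ae_map (by fun_prop) h)

/-- For almost every covariate value the marginal revenue decreases at least linearly. -/
lemma InClass.ae_marginalRevenue_sub_le (hM : M.InClass C₀ Cs Cb Cu Cl) (hC₀ : 0 ≤ C₀) :
    ∀ᵐ x ∂(volume.restrict (Set.Icc (0 : ℝ) 1)), ∀ y ∈ Set.Icc (0 : ℝ) 1,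
      ∀ y' ∈ Set.Icc (0 : ℝ) 1, y' ≤ y →
        M.marginalRevenue y x - M.marginalRevenue y' x ≤ -Cs * (y - y') := by
  filter_upwards [ae_ae_of_ae_unitSquare hM.strongConcave,
    ae_restrict_mem (measurableSet_Icc : MeasurableSet (Set.Icc (0 : ℝ) 1))] with x hae hx
  intro y hy y' hy' hyy
  have hsub : Set.uIcc y' y ⊆ Set.Icc (0 : ℝ) 1 := Set.uIcc_subset_Icc hy' hy
  -- The second derivative exists only almost everywhere. Lipschitz continuity supplies absolute
  -- continuity, so its pointwise bound may still be integrated.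
  have hac : AbsolutelyContinuousOnInterval (fun y => M.marginalRevenue y x) y' y := by
    refine LipschitzOnWith.absolutelyContinuousOnInterval (K := (2 + 3 * C₀).toNNReal)
      (LipschitzOnWith.of_dist_le_mul fun t ht t' ht' => ?_)
    rw [Real.dist_eq, Real.dist_eq]
    exact (hM.abs_marginalRevenue_sub_le hC₀ hx (hsub ht) (hsub ht')).trans
      (mul_le_mul_of_nonneg_right (Real.le_coe_toNNReal _) (abs_nonneg _))
  have hacf : AbsolutelyContinuousOnInterval (fun y => M.condDensity y x) y' y := by
    refine LipschitzOnWith.absolutelyContinuousOnInterval (K := C₀.toNNReal)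
      (LipschitzOnWith.of_dist_le_mul fun t ht t' ht' => ?_)
    rw [Real.dist_eq, Real.dist_eq]
    exact (hM.lipschitz x hx t (hsub ht) t' (hsub ht')).trans
      (mul_le_mul_of_nonneg_right (Real.le_coe_toNNReal _) (abs_nonneg _))
  have hI := hac.integral_deriv_eq_sub
  beta_reduce at hI
  rw [← hI]
  have hconst : ∫ _t in y'..y, -Cs = -Cs * (y - y') := by simp [mul_comm]
  rw [← hconst]
  refine intervalIntegral.integral_mono_ae_restrict hyy hac.intervalIntegrable_deriv
    intervalIntegrable_const ?_
  have hne : ∀ᵐ t ∂(volume : Measure ℝ), t ≠ 0 ∧ t ≠ 1 := by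
    filter_upwards [Measure.ae_ne volume 0, Measure.ae_ne volume 1] with t h0 h1 using ⟨h0, h1⟩
  filter_upwards [ae_restrict_of_ae_restrict_of_subset
      (Set.Icc_subset_Icc hy'.1 hy.2) hae, ae_restrict_of_ae hacf.ae_differentiableAt,
    ae_restrict_of_ae hne, ae_restrict_mem measurableSet_Icc] with t h1 h2 h3 h4
  have ht : t ∈ Set.Ioo (0 : ℝ) 1 :=
    ⟨lt_of_le_of_ne (hy'.1.trans h4.1) (Ne.symm h3.1), lt_of_le_of_ne (h4.2.trans hy.2) h3.2⟩
  have hd := (h2 (by rwa [Set.uIcc_of_le hyy])).hasDerivAt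
  have hd' := ((hM.hasDerivAt_condCDF hx ht).const_sub 1).sub ((hasDerivAt_id t).mul hd)
  have : deriv (fun y => M.marginalRevenue y x) t = -M.condDensity t x
      - (1 * M.condDensity t x + t * deriv (fun y => M.condDensity y x) t) := hd'.deriv
  rw [this]
  linarith

/-- For almost every covariate value the revenue loss is at least quadratic in the distance to the
optimal price. -/
lemma InClass.ae_revenue_le (hM : M.InClass C₀ Cs Cb Cu Cl) (hC₀ : 0 ≤ C₀) :
    ∀ᵐ x ∂(volume.restrict (Set.Icc (0 : ℝ) 1)), ∀ a, M.IsOptimalPrice x a →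
      ∀ p ∈ Set.Icc (0 : ℝ) 1, M.revenue p x ≤ M.revenue a x - Cs / 2 * (p - a) ^ 2 := by
  filter_upwards [hM.ae_marginalRevenue_sub_le hC₀,
    ae_restrict_mem (measurableSet_Icc : MeasurableSet (Set.Icc (0 : ℝ) 1))] with x h hx
  intro a ha p hp
  refine le_sub_sq_of_hasDerivAt (h := fun y => M.revenue y x)
    (g := fun y => M.marginalRevenue y x) ha.1 (hM.continuousOn_revenue hx)
    (fun y hy => hM.hasDerivAt_revenue hx hy) (fun y hy => ?_) hp
  have h0 := hM.marginalRevenue_optimal hx ha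
  have hy' : y ∈ Set.Icc (0 : ℝ) 1 := ⟨hy.1.le, hy.2.le⟩
  rcases le_total a y with hay | hay
  · have := h y hy' a ha.1 hay
    rw [h0, sub_zero] at this
    nlinarith [mul_le_mul_of_nonneg_right this (sub_nonneg.mpr hay)]
  · have := h a ha.1 y hy' hay
    rw [h0, zero_sub] at this
    nlinarith [mul_le_mul_of_nonneg_right this (sub_nonneg.mpr hay)]

end JointModel

/-! ### Lipschitz dependence of the optimal price on the covariate -/

/-- A function on the unit interval that is Lipschitz with the same constant near every point is
Lipschitz. -/
lemma abs_sub_le_of_locally {p : ℝ → ℝ} {L : ℝ} (hL : 0 ≤ L)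
    (h : ∀ x₀ ∈ Set.Icc (0 : ℝ) 1, ∃ ε > 0, ∀ x ∈ Set.Icc (0 : ℝ) 1, ∀ x' ∈ Set.Icc (0 : ℝ) 1,
      |x - x₀| < ε → |x' - x₀| < ε → |p x - p x'| ≤ L * |x - x'|) :
    ∀ x ∈ Set.Icc (0 : ℝ) 1, ∀ x' ∈ Set.Icc (0 : ℝ) 1, |p x - p x'| ≤ L * |x - x'| := by
  have hcont : ContinuousOn p (Set.Icc 0 1) := by
    intro x₀ hx₀
    obtain ⟨ε, hε, hh⟩ := h x₀ hx₀
    rw [Metric.continuousWithinAt_iff]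
    intro δ hδ
    refine ⟨min ε (δ / (L + 1)), by positivity, fun x hx hd => ?_⟩
    rw [Real.dist_eq] at hd ⊢
    have h1 := hh x hx x₀ hx₀ (hd.trans_le (min_le_left _ _)) (by simpa using hε)
    have h2 := hd.trans_le (min_le_right _ _)
    rw [lt_div_iff₀ (by positivity)] at h2
    nlinarith [abs_nonneg (x - x₀)]
  have key : ∀ a ∈ Set.Icc (0 : ℝ) 1, ∀ b ∈ Set.Icc (0 : ℝ) 1, a ≤ b →
      |p b - p a| ≤ L * (b - a) := by
    intro a ha b hb hab
    have hsub : Set.Icc a b ⊆ Set.Icc (0 : ℝ) 1 := Set.Icc_subset_Icc ha.1 hb.2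
    have hcl : IsClosed ({x | |p x - p a| ≤ L * (x - a)} ∩ Set.Icc a b) := by
      have : ContinuousOn (fun x => |p x - p a| - L * (x - a)) (Set.Icc a b) :=
        ((hcont.mono hsub).sub continuousOn_const).abs.sub (by fun_prop)
      have h2 := this.preimage_isClosed_of_isClosed isClosed_Icc (isClosed_Iic (a := (0 : ℝ)))
      convert h2 using 1
      ext x
      simp [and_comm]
    -- Continuous induction from `a`: the set where the bound holds is closed and can always be
    -- extended a little to the right.
    refine hcl.Icc_subset_of_forall_exists_gt (by simp) ?_ ⟨hab, le_rfl⟩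
    rintro x ⟨hx, hxab⟩ y hy
    obtain ⟨ε, hε, hh⟩ := h x (hsub ⟨hxab.1, hxab.2.le⟩)
    have hlt : x < min (x + ε / 2) (min y b) := by
      simp only [lt_min_iff]; exact ⟨by linarith, hy, hxab.2⟩
    set w := min (x + ε / 2) (min y b) with hw
    have hwε : w ≤ x + ε / 2 := min_le_left _ _
    have hwy : w ≤ y := (min_le_right _ _).trans (min_le_left _ _)
    have hwb : w ≤ b := (min_le_right _ _).trans (min_le_right _ _)
    refine ⟨w, ?_, hlt, hwy⟩
    have h1 := hh w (hsub ⟨hxab.1.trans hlt.le, hwb⟩) x (hsub ⟨hxab.1, hxab.2.le⟩)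
      (by rw [abs_of_pos (by linarith)]; linarith) (by simpa using hε)
    rw [abs_of_pos (by linarith : 0 < w - x)] at h1
    have h2 : |p x - p a| ≤ L * (x - a) := hx
    have h3 := abs_sub_le (p w) (p x) (p a)
    show |p w - p a| ≤ L * (w - a)
    nlinarith
  intro x hx x' hx'
  rcases le_total x x' with hle | hle
  · rw [abs_sub_comm, abs_sub_comm x, abs_of_nonneg (sub_nonneg.mpr hle)]
    exact key x hx x' hx' hle
  · rw [abs_of_nonneg (sub_nonneg.mpr hle)]
    exact key x' hx' x hx hle

namespace JointModel

variable {M : JointModel} {C₀ Cs Cb Cu Cl : ℝ}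

/-- Concavity at every covariate value gives monotonicity on the whole open price range, whereas the
quantitative decrease comes from an almost-everywhere assumption. This weaker fact excludes optimal
prices far from the local box. -/
lemma InClass.marginalRevenue_antitone (hM : M.InClass C₀ Cs Cb Cu Cl) {x : ℝ}
    (hx : x ∈ Set.Icc (0 : ℝ) 1) :
    AntitoneOn (fun y => M.marginalRevenue y x) (Set.Ioo 0 1) := by
  have h := ((hM.strictConcave x hx).concaveOn.subset Set.Ioo_subset_Icc_self
    (convex_Ioo 0 1)).antitoneOn_deriv fun y hy => (hM.hasDerivAt_revenue hx hy).differentiableAt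
  intro y hy y' hy' hle
  have := h hy hy' hle
  rwa [(hM.hasDerivAt_revenue hx hy).deriv, (hM.hasDerivAt_revenue hx hy').deriv] at this

/-- In a box where the conditional distribution function and density are `C¹`, the marginal revenue
is Lipschitz in the covariate. -/
lemma InClass.marginalRevenue_lipschitz_covariate (hM : M.InClass C₀ Cs Cb Cu Cl)
    {U : Set (ℝ × ℝ)} {y₀ x₀ r : ℝ}
    (hF : ContDiffOn ℝ 1 (fun z : ℝ × ℝ => M.condCDF z.1 z.2) (U ∩ unitSquare))
    (hf : ContDiffOn ℝ 1 (fun z : ℝ × ℝ => M.condDensity z.1 z.2) (U ∩ unitSquare))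
    (hU : Set.Ioo (y₀ - r) (y₀ + r) ×ˢ Set.Ioo (x₀ - r) (x₀ + r) ⊆ U)
    (hr0 : 0 ≤ y₀ - r) (hr1 : y₀ + r ≤ 1) {y : ℝ} (hy : y ∈ Set.Ioo (y₀ - r) (y₀ + r)) :
    ∀ x ∈ Set.Icc (0 : ℝ) 1 ∩ Set.Ioo (x₀ - r) (x₀ + r),
      ∀ x' ∈ Set.Icc (0 : ℝ) 1 ∩ Set.Ioo (x₀ - r) (x₀ + r),
        |M.marginalRevenue y x - M.marginalRevenue y x'| ≤ Cb * |x - x'| := by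
  set X : Set ℝ := Set.Icc (0 : ℝ) 1 ∩ Set.Ioo (x₀ - r) (x₀ + r) with hX
  set X' : Set ℝ := Set.Ioo (0 : ℝ) 1 ∩ Set.Ioo (x₀ - r) (x₀ + r) with hX'
  set Y : Set ℝ := Set.Ioo (y₀ - r) (y₀ + r) with hY
  have hint : _root_.interior X = X' := by rw [hX, interior_inter, interior_Icc, interior_Ioo]
  have hXc : Convex ℝ X := (convex_Icc _ _).inter (convex_Ioo _ _)
  have hX'X : X' ⊆ X := Set.inter_subset_inter_left _ Set.Ioo_subset_Icc_self
  have hsub : Y ×ˢ X ⊆ U ∩ unitSquare := fun z hz =>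
    ⟨hU ⟨hz.1, hz.2.2⟩, ⟨⟨hr0.trans hz.1.1.le, hz.1.2.le.trans hr1⟩, hz.2.1⟩⟩
  set R : Set (ℝ × ℝ) := Y ×ˢ X' with hR
  have hRo : IsOpen R := isOpen_Ioo.prod (isOpen_Ioo.inter isOpen_Ioo)
  have hRsub : R ⊆ U ∩ unitSquare := (Set.prod_mono le_rfl hX'X).trans hsub
  have hFR := hF.mono hRsub
  have hfR := hf.mono hRsub
  set F : ℝ × ℝ → ℝ := fun z => M.condCDF z.1 z.2 with hFdef
  set f : ℝ × ℝ → ℝ := fun z => M.condDensity z.1 z.2 with hfdef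
  set ψ : ℝ × ℝ → ℝ := fun z => fderiv ℝ F z (0, 1) + z.1 * fderiv ℝ f z (0, 1) with hψ
  have hψc : ContinuousOn ψ R := by
    have h1 := (hFR.continuousOn_fderiv_of_isOpen hRo le_rfl).clm_apply
      (continuousOn_const (c := ((0 : ℝ), (1 : ℝ))))
    have h2 := (hfR.continuousOn_fderiv_of_isOpen hRo le_rfl).clm_apply
      (continuousOn_const (c := ((0 : ℝ), (1 : ℝ))))
    exact h1.add (continuousOn_fst.mul h2)
  have hline : ∀ z : ℝ × ℝ, HasDerivAt (fun x : ℝ => (z.1, x)) ((0 : ℝ), (1 : ℝ)) z.2 := fun z =>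
    (hasDerivAt_const z.2 z.1).prodMk (hasDerivAt_id z.2)
  have hdF : ∀ z ∈ R, HasDerivAt (fun x => M.condCDF z.1 x) (fderiv ℝ F z (0, 1)) z.2 :=
    fun z hz => by
      have := ((hFR.contDiffAt (hRo.mem_nhds hz)).differentiableAt one_ne_zero).hasFDerivAt
      exact HasFDerivAt.comp_hasDerivAt (f := fun x : ℝ => (z.1, x)) z.2 this (hline z)
  have hdf : ∀ z ∈ R, HasDerivAt (fun x => M.condDensity z.1 x) (fderiv ℝ f z (0, 1)) z.2 :=
    fun z hz => by
      have := ((hfR.contDiffAt (hRo.mem_nhds hz)).differentiableAt one_ne_zero).hasFDerivAt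
      exact HasFDerivAt.comp_hasDerivAt (f := fun x : ℝ => (z.1, x)) z.2 this (hline z)
  -- The derivative bound holds almost everywhere, hence on a dense set. As `ψ` is continuous on the
  -- open box, a violation would persist on an open set and meet that dense set.
  have hψb : ∀ z ∈ R, |ψ z| ≤ Cb := by
    by_contra hcon
    push Not at hcon
    obtain ⟨z, hz, hzb⟩ := hcon
    have hopen : IsOpen (R ∩ (fun z => |ψ z|) ⁻¹' Set.Ioi Cb) :=
      hψc.abs.isOpen_inter_preimage hRo isOpen_Ioi
    have hms : MeasurableSet unitSquare := measurableSet_Icc.prod measurableSet_Icc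
    have hd := Measure.dense_of_ae ((ae_restrict_iff' hms).mp hM.bounded_x)
    obtain ⟨w, hw, hwb⟩ := hd.exists_mem_open hopen ⟨z, hz, hzb⟩
    have h1 := (hw (hRsub hwb.1).2).2.2
    rw [(hdF w hwb.1).deriv, (hdf w hwb.1).deriv] at h1
    exact absurd hwb.2 (not_lt.mpr h1)
  have hd : ∀ x ∈ X', HasDerivAt (fun x => M.marginalRevenue y x) (-ψ (y, x)) x := fun x hx => by
    have h1 := ((hdF (y, x) ⟨hy, hx⟩).const_sub 1).sub ((hdf (y, x) ⟨hy, hx⟩).const_mul y)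
    refine h1.congr_deriv ?_
    simp only [hψ]; ring
  have hc : ContinuousOn (fun x => M.marginalRevenue y x) X := by
    have hm : Set.MapsTo (fun x : ℝ => (y, x)) X (U ∩ unitSquare) := fun x hx => hsub ⟨hy, hx⟩
    have h1 : ContinuousOn (fun x => M.condCDF y x) X := hF.continuousOn.comp (by fun_prop) hm
    have h2 : ContinuousOn (fun x => M.condDensity y x) X := hf.continuousOn.comp (by fun_prop) hm
    exact (continuousOn_const.sub h1).sub (continuousOn_const.mul h2)
  have key : ∀ x ∈ X, ∀ x' ∈ X, x ≤ x' →
      |M.marginalRevenue y x' - M.marginalRevenue y x| ≤ Cb * (x' - x) := by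
    intro x hx x' hx' hle
    rw [abs_le]
    constructor
    · have := hXc.mul_sub_le_image_sub_of_le_deriv hc (by
        rw [hint]; exact fun x hx => (hd x hx).differentiableAt.differentiableWithinAt)
        (C := -Cb) (by
        rw [hint]; intro x hx; rw [(hd x hx).deriv]
        linarith [(abs_le.mp (hψb (y, x) ⟨hy, hx⟩)).2]) x hx x' hx' hle
      linarith
    · exact hXc.image_sub_le_mul_sub_of_deriv_le hc (by
        rw [hint]; exact fun x hx => (hd x hx).differentiableAt.differentiableWithinAt)
        (C := Cb) (by
        rw [hint]; intro x hx; rw [(hd x hx).deriv]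
        linarith [(abs_le.mp (hψb (y, x) ⟨hy, hx⟩)).1]) x hx x' hx' hle
  intro x hx x' hx'
  rcases le_total x x' with hle | hle
  · rw [abs_sub_comm, abs_sub_comm x, abs_of_nonneg (sub_nonneg.mpr hle)]
    exact key x hx x' hx' hle
  · rw [abs_of_nonneg (sub_nonneg.mpr hle)]
    exact key x' hx' x hx hle

/-- The optimal price is Lipschitz in the covariate. -/
theorem InClass.optimalPrice_lipschitz (hM : M.InClass C₀ Cs Cb Cu Cl) (hC₀ : 0 ≤ C₀)
    (hCs : 0 < Cs) (hCb : 0 ≤ Cb) {p : ℝ → ℝ}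
    (hp : ∀ x ∈ Set.Icc (0 : ℝ) 1, M.IsOptimalPrice x (p x)) :
    ∀ x ∈ Set.Icc (0 : ℝ) 1, ∀ x' ∈ Set.Icc (0 : ℝ) 1, |p x - p x'| ≤ Cb / Cs * |x - x'| := by
  refine abs_sub_le_of_locally (by positivity) fun x₀ hx₀ => ?_
  obtain ⟨U, hUo, hUp, hF, hf⟩ := hM.smooth
  set y₀ := p x₀ with hy₀
  have hy₀i : y₀ ∈ Set.Ioo (0 : ℝ) 1 := hM.interior x₀ hx₀ _ (hp x₀ hx₀)
  obtain ⟨r₁, hr₁, hball⟩ := Metric.isOpen_iff.mp hUo _ (hUp x₀ hx₀ _ (hp x₀ hx₀))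
  obtain ⟨r, hr, hrr₁, hr0, hr1⟩ : ∃ r > 0, r ≤ r₁ ∧ 0 ≤ y₀ - r ∧ y₀ + r ≤ 1 := by
    refine ⟨min r₁ (min y₀ (1 - y₀)), ?_, min_le_left _ _, ?_, ?_⟩
    · simp only [gt_iff_lt, lt_min_iff]; exact ⟨hr₁, hy₀i.1, by linarith [hy₀i.2]⟩
    · have := (min_le_right r₁ (min y₀ (1 - y₀))).trans (min_le_left _ _); linarith
    · have := (min_le_right r₁ (min y₀ (1 - y₀))).trans (min_le_right _ _); linarith
  have hUr : Set.Ioo (y₀ - r) (y₀ + r) ×ˢ Set.Ioo (x₀ - r) (x₀ + r) ⊆ U := by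
    refine subset_trans ?_ hball
    rw [← ball_prod_same, Real.ball_eq_Ioo, Real.ball_eq_Ioo]
    exact Set.prod_mono (Set.Ioo_subset_Ioo (by linarith) (by linarith))
      (Set.Ioo_subset_Ioo (by linarith) (by linarith))
  set X : Set ℝ := Set.Icc (0 : ℝ) 1 ∩ Set.Ioo (x₀ - r) (x₀ + r) with hX
  set Y : Set ℝ := Set.Ioo (y₀ - r) (y₀ + r) with hY
  have hYI : ∀ y ∈ Y, y ∈ Set.Ioo (0 : ℝ) 1 := fun y hy =>
    ⟨hr0.trans_lt hy.1, hy.2.trans_le hr1⟩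
  have hlip : ∀ y ∈ Y, ∀ x ∈ X, ∀ x' ∈ X,
      |M.marginalRevenue y x - M.marginalRevenue y x'| ≤ Cb * |x - x'| := fun y hy =>
    hM.marginalRevenue_lipschitz_covariate hF hf hUr hr0 hr1 hy
  have hx₀X : x₀ ∈ X := ⟨hx₀, by constructor <;> linarith⟩
  -- By density, the strong monotonicity in the price holds for every nearby covariate value.
  have hmono : ∀ x ∈ X, ∀ y ∈ Y, ∀ y' ∈ Y, y' ≤ y →
      M.marginalRevenue y x - M.marginalRevenue y' x ≤ -Cs * (y - y') := by
    intro x hx y hy y' hy' hle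
    refine le_of_forall_pos_le_add fun ε hε => ?_
    set δ := ε / (2 * (Cb + 1)) with hδ
    have hδ0 : 0 < δ := by positivity
    have hd := Measure.dense_of_ae
      ((ae_restrict_iff' measurableSet_Icc).mp (hM.ae_marginalRevenue_sub_le hC₀))
    set O : Set ℝ := (Set.Ioo (x - δ) (x + δ) ∩ Set.Ioo (x₀ - r) (x₀ + r)) ∩ Set.Ioo 0 1 with hO
    have hOo : IsOpen O := (isOpen_Ioo.inter isOpen_Ioo).inter isOpen_Ioo
    have hOne : O.Nonempty := by
      obtain ⟨⟨hx1, hx2⟩, hx3, hx4⟩ := hx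
      obtain ⟨s, hs0, hs1, hsδ, hsa, hsb⟩ : ∃ s > 0, s ≤ 1 ∧ s ≤ δ ∧ s ≤ x - (x₀ - r) ∧
          s ≤ x₀ + r - x := by
        refine ⟨min (min 1 δ) (min (x - (x₀ - r)) (x₀ + r - x)), ?_,
          (min_le_left _ _).trans (min_le_left _ _), (min_le_left _ _).trans (min_le_right _ _),
          (min_le_right _ _).trans (min_le_left _ _), (min_le_right _ _).trans (min_le_right _ _)⟩
        simp only [gt_iff_lt, lt_min_iff]
        exact ⟨⟨one_pos, hδ0⟩, by linarith, by linarith⟩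
      have hsx0 : 0 ≤ s * x := by positivity
      have hsx1 : s * x ≤ s := by nlinarith
      -- Moving slightly towards `1/2` brings a possible endpoint into the open unit interval.
      refine ⟨x + s * (1 / 2 - x), ⟨⟨?_, ?_⟩, ?_, ?_⟩, ?_, ?_⟩ <;> nlinarith
    obtain ⟨w, hw, hwO⟩ := hd.exists_mem_open hOo hOne
    have hwI : w ∈ Set.Icc (0 : ℝ) 1 := ⟨hwO.2.1.le, hwO.2.2.le⟩
    have hwX : w ∈ X := ⟨hwI, hwO.1.2⟩
    have h1 := hw hwI y ⟨(hYI y hy).1.le, (hYI y hy).2.le⟩ y'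
      ⟨(hYI y' hy').1.le, (hYI y' hy').2.le⟩ hle
    have h2 := (abs_le.mp (hlip y hy x hx w hwX)).2
    have h3 := (abs_le.mp (hlip y' hy' x hx w hwX)).1
    have h4 : |x - w| ≤ δ := by
      rw [abs_le]; constructor <;> linarith [hwO.1.1.1, hwO.1.1.2]
    have h5 : Cb * |x - w| ≤ ε / 2 := by
      have : Cb * |x - w| ≤ (Cb + 1) * δ :=
        mul_le_mul (by linarith) h4 (abs_nonneg _) (by linarith)
      refine this.trans (le_of_eq ?_)
      rw [hδ]; field_simp
    linarith
  have hφ0 : ∀ x ∈ Set.Icc (0 : ℝ) 1, M.marginalRevenue (p x) x = 0 := fun x hx =>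
    hM.marginalRevenue_optimal hx (hp x hx)
  set e := r / 2 with he
  have he0 : 0 < e := by positivity
  have hm : y₀ - e ∈ Y := by constructor <;> linarith
  have hm' : y₀ + e ∈ Y := by constructor <;> linarith
  have hy₀Y : y₀ ∈ Y := by constructor <;> linarith
  -- Within this radius the covariate changes the marginal revenue by less than `Cs * e`, its
  -- guaranteed size at `y₀ - e` and `y₀ + e`, so its signs there persist. The `+ 1` allows `Cb =
  -- 0`.
  set ε := min r (Cs * e / (Cb + 1)) with hε
  have hε0 : 0 < ε := by positivity
  have hεr : ε ≤ r := min_le_left _ _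
  have hnear : ∀ x ∈ Set.Icc (0 : ℝ) 1, |x - x₀| < ε → x ∈ X ∧ p x ∈ Y := by
    intro x hx hxε
    have hxX : x ∈ X := by
      have := abs_lt.mp (hxε.trans_le hεr)
      exact ⟨hx, by constructor <;> linarith [this.1, this.2]⟩
    have hsmall : Cb * |x - x₀| < Cs * e := by
      have h1 := hxε.trans_le (min_le_right _ _)
      rw [lt_div_iff₀ (by positivity)] at h1
      nlinarith [abs_nonneg (x - x₀)]
    have hpi := hM.interior x hx _ (hp x hx)
    refine ⟨hxX, ?_, ?_⟩
    -- A price this low would, by concavity, force a nonpositive marginal revenue at `y₀ - e`,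
    -- against the sign preserved from `x₀`; the upper side is symmetric.
    · by_contra hcon
      have h1 := hmono x₀ hx₀X y₀ hy₀Y _ hm (by linarith)
      rw [hφ0 x₀ hx₀] at h1
      have h2 := (abs_le.mp (hlip _ hm x hxX x₀ hx₀X)).1
      have h3 := hM.marginalRevenue_antitone hx hpi (hYI _ hm) (by linarith)
      beta_reduce at h3
      rw [hφ0 x hx] at h3
      linarith
    · by_contra hcon
      have h1 := hmono x₀ hx₀X _ hm' y₀ hy₀Y (by linarith)
      rw [hφ0 x₀ hx₀] at h1
      have h2 := (abs_le.mp (hlip _ hm' x hxX x₀ hx₀X)).2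
      have h3 := hM.marginalRevenue_antitone hx (hYI _ hm') hpi (by linarith)
      beta_reduce at h3
      rw [hφ0 x hx] at h3
      linarith
  have key : ∀ x ∈ Set.Icc (0 : ℝ) 1, ∀ x' ∈ Set.Icc (0 : ℝ) 1, |x - x₀| < ε → |x' - x₀| < ε →
      p x' ≤ p x → |p x - p x'| ≤ Cb / Cs * |x - x'| := by
    intro x hx x' hx' hxε hxε' hle
    obtain ⟨hxX, hpx⟩ := hnear x hx hxε
    obtain ⟨hxX', hpx'⟩ := hnear x' hx' hxε'
    -- Both marginal revenues vanish at their optima: the decrease in the price, with rate `Cs`,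
    -- must be paid for by the covariate change, with rate `Cb`.
    have h1 := hmono x' hxX' _ hpx _ hpx' hle
    have h2 := (abs_le.mp (hlip _ hpx x hxX x' hxX')).2
    rw [hφ0 x hx] at h2
    rw [hφ0 x' hx'] at h1
    rw [abs_of_nonneg (sub_nonneg.mpr hle), div_mul_eq_mul_div, le_div_iff₀ hCs]
    linarith
  refine ⟨ε, hε0, fun x hx x' hx' hxε hxε' => ?_⟩
  rcases le_total (p x') (p x) with hle | hle
  · exact key x hx x' hx' hxε hxε' hle
  · rw [abs_sub_comm, abs_sub_comm x]
    exact key x' hx' x hx hxε' hxε hle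

end JointModel

/-! ### Markets, the law of the data and the population drift -/

lemma measurableSet_market (K : ℕ) (k : Fin K) : MeasurableSet (market K k) := measurableSet_Ico

lemma market_subset_Ico {K : ℕ} (k : Fin K) : market K k ⊆ Set.Ico (0 : ℝ) 1 := by
  have hK : (0 : ℝ) < K := by exact_mod_cast k.pos
  have hk : ((k : ℕ) : ℝ) + 1 ≤ K := by exact_mod_cast k.2
  refine Set.Ico_subset_Ico (by positivity) ?_
  rwa [div_le_one hK]

lemma market_subset_Icc {K : ℕ} (k : Fin K) : market K k ⊆ Set.Icc (0 : ℝ) 1 :=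
  (market_subset_Ico k).trans Set.Ico_subset_Icc_self

lemma volume_real_market {K : ℕ} (k : Fin K) : volume.real (market K k) = 1 / K := by
  unfold market
  rw [Real.volume_real_Ico_of_le (by gcongr; linarith)]
  ring

lemma abs_sub_le_of_mem_market {K : ℕ} {k : Fin K} {x x' : ℝ} (hx : x ∈ market K k)
    (hx' : x' ∈ market K k) : |x - x'| ≤ 1 / K := by
  have e : (((k : ℕ) : ℝ) + 1) / K = ((k : ℕ) : ℝ) / K + 1 / K := by ring
  have h1 := hx.1; have h2 := hx.2; have h3 := hx'.1; have h4 := hx'.2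
  rw [e] at h2 h4
  rw [abs_le]; constructor <;> linarith

namespace JointModel

variable {M : JointModel} {C₀ Cs Cb Cu Cl : ℝ}

lemma measurable_condCDF (M : JointModel) :
    Measurable (fun z : ℝ × ℝ => M.condCDF z.1 z.2) := by
  have key : ∀ s : Set ((ℝ × ℝ) × ℝ), MeasurableSet s →
      Measurable (fun z : ℝ × ℝ => ∫ t, s.indicator (fun w => M.condDensity w.2 w.1.2) (z, t)) := by
    intro s hs
    have h1 : Measurable (fun w : (ℝ × ℝ) × ℝ => M.condDensity w.2 w.1.2) :=
      M.measurable_condDensity.comp (by fun_prop : Measurable fun w : (ℝ × ℝ) × ℝ => (w.2, w.1.2))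
    exact (StronglyMeasurable.integral_prod_right' (h1.indicator hs).stronglyMeasurable).measurable
  have f1 : Measurable fun w : (ℝ × ℝ) × ℝ => w.2 := measurable_snd
  have f2 : Measurable fun w : (ℝ × ℝ) × ℝ => w.1.1 := measurable_fst.comp measurable_fst
  have hs1 : MeasurableSet {w : (ℝ × ℝ) × ℝ | 0 < w.2 ∧ w.2 ≤ w.1.1} :=
    (measurableSet_lt measurable_const f1).inter (measurableSet_le f1 f2)
  have hs2 : MeasurableSet {w : (ℝ × ℝ) × ℝ | w.1.1 < w.2 ∧ w.2 ≤ 0} :=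
    (measurableSet_lt f2 f1).inter (measurableSet_le f1 measurable_const)
  -- Negative upper limits count too: the oriented integral is a difference of integrals over
  -- measurable regions.
  convert (key _ hs1).sub (key _ hs2) using 1
  ext z
  simp only [Pi.sub_apply, condCDF, intervalIntegral]
  rw [← integral_indicator measurableSet_Ioc, ← integral_indicator measurableSet_Ioc]
  rfl

lemma measurable_revenue (M : JointModel) :
    Measurable (fun z : ℝ × ℝ => M.revenue z.1 z.2) :=
  (measurable_const.sub M.measurable_condCDF).mul measurable_fst

lemma InClass.revenue_mem_Icc (hM : M.InClass C₀ Cs Cb Cu Cl) {x y : ℝ}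
    (hx : x ∈ Set.Icc (0 : ℝ) 1) (hy : y ∈ Set.Icc (0 : ℝ) 1) :
    M.revenue y x ∈ Set.Icc (0 : ℝ) 1 := by
  have h := hM.condCDF_mem_Icc hx hy
  unfold revenue
  constructor
  · exact mul_nonneg (by linarith [h.2]) hy.1
  · exact mul_le_one₀ (by linarith [h.1]) hy.1 hy.2

lemma InClass.integrableOn_mul_margDensity (hM : M.InClass C₀ Cs Cb Cu Cl) {g : ℝ → ℝ}
    (hg : Measurable g) {c : ℝ} (hgc : ∀ x ∈ Set.Icc (0 : ℝ) 1, |g x| ≤ c) {B : Set ℝ}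
    (hB : MeasurableSet B) (hB1 : B ⊆ Set.Icc 0 1) :
    IntegrableOn (fun x => g x * M.margDensity x) B := by
  refine Measure.integrableOn_of_bounded (M := c * Cu)
    ((measure_mono hB1).trans_lt measure_Icc_lt_top).ne
    (hg.mul M.measurable_margDensity).aestronglyMeasurable ?_
  filter_upwards [ae_restrict_mem hB] with x hx
  have h1 := hM.marginal x (hB1 hx)
  have h2 := M.margDensity_nonneg x (hB1 hx)
  rw [Real.norm_eq_abs, abs_mul, abs_of_nonneg h2]
  exact mul_le_mul (hgc x (hB1 hx)) h1.2 h2 ((abs_nonneg _).trans (hgc x (hB1 hx)))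

lemma law_prod_apply (M : JointModel) {p : ℝ} (hp : p ∈ Set.Icc (0 : ℝ) 1) {B : Set ℝ}
    (hB : MeasurableSet B) (hB1 : B ⊆ Set.Icc 0 1) :
    M.law (Set.Ici p ×ˢ B) = ∫⁻ x in B, ∫⁻ y in Set.Icc p 1,
      ENNReal.ofReal (M.condDensity y x * M.margDensity x) := by
  have e : (Set.Ici p ×ˢ B) ∩ unitSquare = Set.Icc p 1 ×ˢ B := by
    ext ⟨y, x⟩
    simp only [unitSquare, Set.mem_inter_iff, Set.mem_prod, Set.mem_Ici, Set.mem_Icc]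
    constructor
    · rintro ⟨⟨h1, h2⟩, ⟨h3, h4⟩, h5⟩; exact ⟨⟨h1, h4⟩, h2⟩
    · rintro ⟨⟨h1, h2⟩, h3⟩; exact ⟨⟨h1, h3⟩, ⟨hp.1.trans h1, h2⟩, hB1 h3⟩
  rw [law, withDensity_apply _ (measurableSet_Ici.prod hB),
    Measure.restrict_restrict (measurableSet_Ici.prod hB), e, Measure.volume_eq_prod,
    ← Measure.prod_restrict, lintegral_prod_symm]
  exact (M.measurable_condDensity.mul
    (M.measurable_margDensity.comp measurable_snd)).ennreal_ofReal.aemeasurable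

lemma InClass.law_prod (hM : M.InClass C₀ Cs Cb Cu Cl) {p : ℝ} (hp : p ∈ Set.Icc (0 : ℝ) 1)
    {B : Set ℝ} (hB : MeasurableSet B) (hB1 : B ⊆ Set.Icc 0 1) :
    M.law (Set.Ici p ×ˢ B)
      = ENNReal.ofReal (∫ x in B, (1 - M.condCDF p x) * M.margDensity x) := by
  have hnn : ∀ x ∈ B, 0 ≤ (1 - M.condCDF p x) * M.margDensity x := fun x hx =>
    mul_nonneg (by linarith [(hM.condCDF_mem_Icc (hB1 hx) hp).2]) (M.margDensity_nonneg x (hB1 hx))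
  rw [M.law_prod_apply hp hB hB1, ofReal_integral_eq_lintegral_ofReal]
  · refine setLIntegral_congr_fun hB fun x hx => ?_
    have hx1 := hB1 hx
    have h1 : (1 : ℝ) ∈ Set.Icc (0 : ℝ) 1 := by simp
    have hI := (intervalIntegrable_iff_integrableOn_Icc_of_le hp.2).mp
      (hM.intervalIntegrable_condDensity hx1 hp h1)
    rw [← ofReal_integral_eq_lintegral_ofReal (hI.mul_const _)]
    · rw [integral_mul_const, integral_Icc_eq_integral_Ioc,
        ← intervalIntegral.integral_of_le hp.2, ← hM.condCDF_sub hx1 hp h1]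
      have : M.condCDF 1 x = 1 := M.integral_condDensity x hx1
      rw [this]
    · filter_upwards [ae_restrict_mem measurableSet_Icc] with y hy
      exact mul_nonneg (M.condDensity_nonneg y ⟨hp.1.trans hy.1, hy.2⟩ x hx1)
        (M.margDensity_nonneg x hx1)
  · refine hM.integrableOn_mul_margDensity (g := fun x => 1 - M.condCDF p x) (c := 1)
      (measurable_const.sub (M.measurable_condCDF.comp measurable_prodMk_left))
      (fun x hx => ?_) hB hB1
    have := hM.condCDF_mem_Icc hx hp
    rw [abs_le]; constructor <;> linarith [this.1, this.2]
  · filter_upwards [ae_restrict_mem hB] with x hx using hnn x hx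

lemma InClass.isProbabilityMeasure_law (hM : M.InClass C₀ Cs Cb Cu Cl) :
    IsProbabilityMeasure M.law := by
  constructor
  have h1 : M.law Set.univ = M.law (Set.Ici 0 ×ˢ Set.Icc (0 : ℝ) 1) := by
    have hc : M.law (Set.Ici 0 ×ˢ Set.Icc (0 : ℝ) 1)ᶜ = 0 := by
      refine withDensity_absolutelyContinuous _ _ ?_
      rw [Measure.restrict_apply (measurableSet_Ici.prod measurableSet_Icc).compl]
      convert measure_empty (μ := (volume : Measure (ℝ × ℝ)))
      ext ⟨y, x⟩
      simp only [unitSquare, Set.mem_inter_iff, Set.mem_compl_iff, Set.mem_prod, Set.mem_Ici,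
        Set.mem_empty_iff_false, iff_false]
      rintro ⟨h1, h2, h3⟩; exact h1 ⟨h2.1, h3⟩
    rw [← measure_add_measure_compl (measurableSet_Ici.prod measurableSet_Icc), hc, add_zero]
  rw [h1, hM.law_prod (by simp) measurableSet_Icc le_rfl]
  have h2 : ∀ x, M.condCDF 0 x = 0 := fun x => by simp [condCDF]
  simp only [h2, sub_zero, one_mul]
  rw [integral_Icc_eq_integral_Ioc, ← intervalIntegral.integral_of_le zero_le_one,
    M.integral_margDensity, ENNReal.ofReal_one]

/-- Sales at the price `p` to covariate values in `B`, times the price. -/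
lemma InClass.mul_law_real_prod (hM : M.InClass C₀ Cs Cb Cu Cl) {p : ℝ}
    (hp : p ∈ Set.Icc (0 : ℝ) 1) {B : Set ℝ} (hB : MeasurableSet B) (hB1 : B ⊆ Set.Icc 0 1) :
    p * M.law.real (Set.Ici p ×ˢ B) = ∫ x in B, M.revenue p x * M.margDensity x := by
  rw [measureReal_def, hM.law_prod hp hB hB1, ENNReal.toReal_ofReal, ← integral_const_mul]
  · refine integral_congr_ae (Filter.Eventually.of_forall fun x => ?_)
    simp only [revenue]; ring
  · exact setIntegral_nonneg hB fun x hx => mul_nonneg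
      (by linarith [(hM.condCDF_mem_Icc (hB1 hx) hp).2]) (M.margDensity_nonneg x (hB1 hx))

/-- The joint density is at most `(1 + C₀) * Cu` and a market has width `1 / K`. After
multiplication by `n` this is the mass hypothesis of the maximal inequality with `lam = n / K`. -/
lemma InClass.law_real_le (hM : M.InClass C₀ Cs Cb Cu Cl) (hC₀ : 0 ≤ C₀) (hCu : 0 ≤ Cu)
    {A : Set (ℝ × ℝ)} (hA : MeasurableSet A) {K : ℕ} {k : Fin K} {a b : ℝ} (hab : a ≤ b)
    (hsub : A ∩ unitSquare ⊆ Set.Ico a b ×ˢ market K k) :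
    M.law.real A ≤ (1 + C₀) * Cu / K * (b - a) := by
  have h1 : M.law A ≤ ENNReal.ofReal ((1 + C₀) * Cu) * volume (A ∩ unitSquare) := by
    rw [law, withDensity_apply _ hA, Measure.restrict_restrict hA,
      ← setLIntegral_const]
    refine setLIntegral_mono measurable_const fun z hz => ENNReal.ofReal_le_ofReal ?_
    have hz1 := hz.2.1; have hz2 := hz.2.2
    exact mul_le_mul (hM.condDensity_le hC₀ hz2 hz1) (hM.marginal _ hz2).2
      (M.margDensity_nonneg _ hz2) (by linarith)
  have h2 : volume (A ∩ unitSquare) ≤ ENNReal.ofReal ((b - a) * (1 / K)) := by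
    refine (measure_mono hsub).trans (le_of_eq ?_)
    rw [Measure.volume_eq_prod, Measure.prod_prod, Real.volume_Ico,
      ENNReal.ofReal_mul (by linarith), ← volume_real_market k, ofReal_measureReal (by
        exact ((measure_mono (market_subset_Icc k)).trans_lt measure_Icc_lt_top).ne)]
  have h3 := h1.trans (mul_le_mul_right h2 _)
  rw [← ENNReal.ofReal_mul (by positivity)] at h3
  refine (ENNReal.toReal_le_of_le_ofReal ?_ h3).trans (le_of_eq (by ring))
  have : 0 ≤ b - a := by linarith
  positivity

/-- Away from the optimal price at `x₀`, the revenue in the market of `x₀` is smaller by an amount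
quadratic in the distance. -/
lemma InClass.market_revenue_drift (hM : M.InClass C₀ Cs Cb Cu Cl) (hC₀ : 0 ≤ C₀)
    (hCs : 0 < Cs) (hCb : 0 ≤ Cb) (hCl : 0 < Cl) {pstar : ℝ → ℝ}
    (hp : ∀ x ∈ Set.Icc (0 : ℝ) 1, M.IsOptimalPrice x (pstar x)) {K : ℕ} {k : Fin K} {x₀ : ℝ}
    (hx₀ : x₀ ∈ market K k) {p : ℝ} (hpI : p ∈ Set.Icc (0 : ℝ) 1)
    (hfar : (2 * (Cb / Cs) * ((Cs + (2 + 3 * C₀)) / Cs) + 1) / K ≤ |p - pstar x₀|) :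
    p * M.law.real (Set.Ici p ×ˢ market K k)
        - pstar x₀ * M.law.real (Set.Ici (pstar x₀) ×ˢ market K k)
      ≤ -(Cs * Cl / 8) * (1 / K) * (p - pstar x₀) ^ 2 := by
  have hK : (0 : ℝ) < K := by exact_mod_cast k.pos
  have hx₀I := market_subset_Icc k hx₀
  set q := pstar x₀ with hq
  have hqI : q ∈ Set.Icc (0 : ℝ) 1 := (hp x₀ hx₀I).1
  have hBm := measurableSet_market K k
  have hBI := market_subset_Icc k
  have hrev : ∀ p ∈ Set.Icc (0 : ℝ) 1,
      IntegrableOn (fun x => M.revenue p x * M.margDensity x) (market K k) := fun p hp =>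
    hM.integrableOn_mul_margDensity (g := fun x => M.revenue p x) (c := 1)
      (M.measurable_revenue.comp measurable_prodMk_left)
      (fun x hx => by
        have := hM.revenue_mem_Icc hx hp
        rw [abs_of_nonneg this.1]; exact this.2) hBm hBI
  rw [hM.mul_law_real_prod hpI hBm hBI, hM.mul_law_real_prod hqI hBm hBI,
    ← integral_sub (hrev p hpI) (hrev q hqI)]
  have hpt : ∀ᵐ x ∂(volume.restrict (market K k)),
      M.revenue p x * M.margDensity x - M.revenue q x * M.margDensity x
        ≤ -(Cs / 8 * (p - q) ^ 2 * Cl) := by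
    filter_upwards [ae_restrict_of_ae_restrict_of_subset hBI (hM.ae_revenue_le hC₀),
      ae_restrict_mem hBm] with x hx hxB
    have hxI := hBI hxB
    have h1 := hx _ (hp x hxI) p hpI
    have h2 := hM.revenue_optimal_sub_le hC₀ hxI (hp x hxI) hqI
    have h3 : |q - pstar x| ≤ Cb / Cs * (1 / K) :=
      (hM.optimalPrice_lipschitz hC₀ hCs hCb hp x₀ hx₀I x hxI).trans
        (mul_le_mul_of_nonneg_left (abs_sub_le_of_mem_market hx₀ hxB) (by positivity))
    set ratio := (Cs + (2 + 3 * C₀)) / Cs with hratio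
    have hratio1 : 1 ≤ ratio := by rw [hratio, le_div_iff₀ hCs]; linarith
    have hratioCs : ratio * Cs = Cs + (2 + 3 * C₀) := by rw [hratio]; field_simp
    -- The distance assumption is calibrated here: it dominates the variation of the optimal price
    -- in the market by the factor `2 * ratio`, so the loss of `q` at `x` uses up only half of the
    -- gain `Cs / 4 * (p - q) ^ 2`, leaving `Cs / 8`.
    have h4 : 2 * ratio * |q - pstar x| ≤ |p - q| := by
      refine le_trans ?_ hfar
      rw [le_div_iff₀ hK]
      have h5 : |q - pstar x| * K ≤ Cb / Cs := by
        have := mul_le_mul_of_nonneg_right h3 hK.le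
        rwa [mul_assoc, one_div, inv_mul_cancel₀ hK.ne', mul_one] at this
      nlinarith
    have h6 : 4 * ratio * (q - pstar x) ^ 2 ≤ (p - q) ^ 2 := by
      rw [← sq_abs (q - pstar x), ← sq_abs (p - q)]
      have h7 : (2 * ratio * |q - pstar x|) ^ 2 ≤ |p - q| ^ 2 :=
        pow_le_pow_left₀ (by positivity) h4 2
      refine le_trans ?_ h7
      have : ratio ≤ ratio ^ 2 := by nlinarith
      nlinarith [sq_nonneg |q - pstar x|]
    have h8 : 4 * (Cs + (2 + 3 * C₀)) * (q - pstar x) ^ 2 ≤ Cs * (p - q) ^ 2 := by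
      rw [← hratioCs]
      have := mul_le_mul_of_nonneg_left h6 hCs.le
      linarith
    have h9 : (p - q) ^ 2 ≤ 2 * (p - pstar x) ^ 2 + 2 * (q - pstar x) ^ 2 := by
      nlinarith [sq_nonneg ((p - pstar x) + (q - pstar x))]
    have h10 : M.revenue p x - M.revenue q x ≤ -(Cs / 8 * (p - q) ^ 2) := by
      nlinarith
    have hm := (hM.marginal x hxI).1
    have h11 : 0 ≤ Cs / 8 * (p - q) ^ 2 := by positivity
    rw [← sub_mul]
    nlinarith
  refine (setIntegral_mono_ae_restrict ((hrev p hpI).sub (hrev q hqI))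
    (integrableOn_const (((measure_mono hBI).trans_lt measure_Icc_lt_top).ne)) hpt).trans
    (le_of_eq ?_)
  rw [setIntegral_const, volume_real_market, smul_eq_mul]
  ring

end JointModel

/-! ### The basic inequality and the mean squared price error -/

lemma countDeviation_eq_sub {α : Type*} [MeasurableSpace α] {n : ℕ} {ν : Measure α} (A : Set α)
    (z : Fin n → α) :
    countDeviation ν A z = ∑ i, A.indicator (fun _ => (1 : ℝ)) (z i) - n * ν.real A := by
  simp [countDeviation]

lemma salesSet_eq (K : ℕ) (k : Fin K) (p : ℝ) :
    {z : ℝ × ℝ | z.2 ∈ market K k ∧ p ≤ z.1} = Set.Ici p ×ˢ market K k := by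
  ext z
  exact and_comm

/-- An empirical revenue maximizer also maximizes the price times the number of sales. -/
lemma IsKMarketsERM.mul_sum_le {n K : ℕ} {phat : (Fin n → ℝ × ℝ) → Fin K → ℝ}
    (h : IsKMarketsERM phat) (data : Fin n → ℝ × ℝ) (k : Fin K) {q : ℝ}
    (hq : q ∈ Set.Icc (0 : ℝ) 1) :
    q * ∑ i, (Set.Ici q ×ˢ market K k).indicator (fun _ => (1 : ℝ)) (data i)
      ≤ phat data k *
        ∑ i, (Set.Ici (phat data k) ×ˢ market K k).indicator (fun _ => (1 : ℝ)) (data i) := by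
  have hle : ∀ p : ℝ, ∑ i, (Set.Ici p ×ˢ market K k).indicator (fun _ => (1 : ℝ)) (data i)
      ≤ marketCount K data k := fun p =>
    Finset.sum_le_sum fun i _ => Set.indicator_le_indicator_of_subset (fun z hz => hz.2)
      (fun _ => zero_le_one) _
  have hnn : ∀ p : ℝ, 0 ≤ ∑ i, (Set.Ici p ×ˢ market K k).indicator (fun _ => (1 : ℝ)) (data i) :=
    fun p => Finset.sum_nonneg fun i _ => Set.indicator_nonneg (fun _ _ => zero_le_one) _
  have hmax := (h.2 data k).2 q hq
  unfold empiricalRevenue at hmax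
  rw [salesSet_eq, salesSet_eq] at hmax
  -- In an empty market both sales counts vanish; otherwise the common denominator cancels.
  rcases ((hnn q).trans (hle q)).eq_or_lt with h0 | hpos
  · have h1 := le_antisymm ((hle q).trans h0.ge) (hnn q)
    have h2 := le_antisymm ((hle (phat data k)).trans h0.ge) (hnn (phat data k))
    rw [h1, h2, mul_zero, mul_zero]
  · rwa [← mul_div_assoc, ← mul_div_assoc, div_le_div_iff_of_pos_right hpos] at hmax

namespace JointModel

variable {M : JointModel} {C₀ Cs Cb Cu Cl : ℝ}

/-- The basic inequality: a price far from optimal that is empirically better than the optimal one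
forces a large deviation of the empirical process. -/
lemma drift_le_deviation {ν : Measure (ℝ × ℝ)} [IsFiniteMeasure ν] {n : ℕ} {B : Set ℝ}
    (hB : MeasurableSet B) {data : Fin n → ℝ × ℝ} {p q c : ℝ} (hp : p ∈ Set.Icc (0 : ℝ) 1)
    (hmax : q * ∑ i, (Set.Ici q ×ˢ B).indicator (fun _ => (1 : ℝ)) (data i)
      ≤ p * ∑ i, (Set.Ici p ×ˢ B).indicator (fun _ => (1 : ℝ)) (data i))
    (hdrift : p * ν.real (Set.Ici p ×ˢ B) - q * ν.real (Set.Ici q ×ˢ B) ≤ -c) :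
    n * c ≤ |p - q| * |countDeviation ν (Set.Ici q ×ˢ B) data|
      + max |countDeviation ν (Set.Ico q (q + |p - q|) ×ˢ B) data|
        |countDeviation ν (Set.Ico (q - |p - q|) q ×ˢ B) data| := by
  have hm : ∀ a : ℝ, MeasurableSet (Set.Ici a ×ˢ B) := fun a => measurableSet_Ici.prod hB
  -- Centring the empirical comparison exposes the drift. With `W` the deviation over the interval
  -- between `p` and `q`, the right side equals `(p - q) * Wq` plus or minus `p * W`, separating one
  -- fixed set from the local increment.
  have e1 : n * c ≤ p * countDeviation ν (Set.Ici p ×ˢ B) data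
      - q * countDeviation ν (Set.Ici q ×ˢ B) data := by
    rw [countDeviation_eq_sub, countDeviation_eq_sub]
    have := mul_le_mul_of_nonneg_left hdrift (Nat.cast_nonneg n : (0 : ℝ) ≤ n)
    linarith
  have hdiff : ∀ a b : ℝ, a ≤ b → countDeviation ν (Set.Ici a ×ˢ B) data
      - countDeviation ν (Set.Ici b ×ˢ B) data = countDeviation ν (Set.Ico a b ×ˢ B) data := by
    intro a b hab
    rw [countDeviation_sub (hm b) (Set.prod_mono (Set.Ici_subset_Ici.mpr hab) le_rfl)]
    congr 1
    ext z
    simp only [Set.mem_sdiff, Set.mem_prod, Set.mem_Ici, Set.mem_Ico]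
    constructor
    · rintro ⟨⟨h1, h2⟩, h3⟩; exact ⟨⟨h1, not_le.mp fun h => h3 ⟨h, h2⟩⟩, h2⟩
    · rintro ⟨⟨h1, h2⟩, h3⟩; exact ⟨⟨h1, h3⟩, fun h => absurd h.1 (not_le.mpr h2)⟩
  set Wq := countDeviation ν (Set.Ici q ×ˢ B) data
  have e2 : (p - q) * Wq ≤ |p - q| * |Wq| := by rw [← abs_mul]; exact le_abs_self _
  rcases le_total q p with hqp | hpq
  · have h1 := hdiff q p hqp
    have h2 : q + |p - q| = p := by rw [abs_of_nonneg (sub_nonneg.mpr hqp)]; ring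
    rw [h2]
    set W := countDeviation ν (Set.Ico q p ×ˢ B) data
    have h3 : -(p * W) ≤ |W| := by
      have : p * |W| ≤ |W| := mul_le_of_le_one_left (abs_nonneg _) hp.2
      have := mul_le_mul_of_nonneg_left (neg_abs_le W) hp.1
      linarith
    have h4 := le_max_left |W| |countDeviation ν (Set.Ico (q - |p - q|) q ×ˢ B) data|
    have h5 : countDeviation ν (Set.Ici p ×ˢ B) data = Wq - W := by linarith
    rw [h5] at e1
    linarith
  · have h1 := hdiff p q hpq
    have h2 : q - |p - q| = p := by rw [abs_of_nonpos (sub_nonpos.mpr hpq)]; ring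
    rw [h2]
    set W := countDeviation ν (Set.Ico p q ×ˢ B) data
    have h3 : p * W ≤ |W| := by
      have : p * |W| ≤ |W| := mul_le_of_le_one_left (abs_nonneg _) hp.2
      have := mul_le_mul_of_nonneg_left (le_abs_self W) hp.1
      linarith
    have h4 := le_max_right |countDeviation ν (Set.Ico q (q + |p - q|) ×ˢ B) data| |W|
    have h5 : countDeviation ν (Set.Ici p ×ˢ B) data = Wq + W := by linarith
    rw [h5] at e1
    linarith

/-- The mean squared error of the empirical price in a market, relative to the optimal price at any
covariate value of the market. -/
theorem exists_integral_sq_sub_le (C₀ Cs Cb Cu Cl : ℝ) (hC₀ : 0 < C₀) (hCs : 0 < Cs)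
    (hCb : 0 < Cb) (hCu : 0 < Cu) (hCl : 0 < Cl) :
    ∃ C : ℝ, 0 < C ∧ ∀ n K : ℕ, 0 < K → K ≤ n →
      ∀ phat : (Fin n → ℝ × ℝ) → Fin K → ℝ, IsKMarketsERM phat →
      ∀ M : JointModel, M.InClass C₀ Cs Cb Cu Cl →
      ∀ pstar : ℝ → ℝ, (∀ x ∈ Set.Icc (0 : ℝ) 1, M.IsOptimalPrice x (pstar x)) →
      ∀ k : Fin K, ∀ x₀ ∈ market K k,
        ∫ data, (phat data k - pstar x₀) ^ 2 ∂(M.sampleLaw n)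
          ≤ C * (((K : ℝ) / n) ^ (2 / 3 : ℝ) + 1 / (K : ℝ) ^ 2) := by
  set ρ := (1 + C₀) * Cu with hρ
  have hρ0 : 0 < ρ := by positivity
  set c := Cs * Cl / 8 with hc
  have hc0 : 0 < c := by positivity
  set a := 2 * (Cb / Cs) * ((Cs + (2 + 3 * C₀)) / Cs) + 1 with ha
  have ha0 : 0 < a := by positivity
  obtain ⟨C₁, hC₁, htail⟩ := exists_tail_bound_monotone_family hρ0 (half_pos hc0)
  set C₂ := 2 * C₁ + 32 * ρ / c ^ 2 with hC₂
  have hC₂0 : 0 < C₂ := by positivity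
  refine ⟨(1 + 8 * C₂) * (1 + a ^ 2), by positivity, ?_⟩
  intro n K hK hKn phat hphat M hM pstar hp k x₀ hx₀
  have : IsProbabilityMeasure M.law := hM.isProbabilityMeasure_law
  have hprob : IsProbabilityMeasure (M.sampleLaw n) := by unfold sampleLaw; infer_instance
  have hK0 : (0 : ℝ) < K := by exact_mod_cast hK
  have hKn' : (K : ℝ) ≤ n := by exact_mod_cast hKn
  have hn0 : (0 : ℝ) < n := hK0.trans_le hKn'
  have hx₀I := market_subset_Icc k hx₀
  set q := pstar x₀ with hq
  have hqI : q ∈ Set.Icc (0 : ℝ) 1 := (hp x₀ hx₀I).1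
  set B := market K k with hB
  have hBm : MeasurableSet B := measurableSet_market K k
  set lam : ℝ := n / K with hlam
  have hlam0 : 0 < lam := by positivity
  set δ : ℝ := ((K : ℝ) / n) ^ (1 / 3 : ℝ) with hδ
  have hδ0 : 0 < δ := by positivity
  have hδ3 : lam * δ ^ 3 = 1 := by
    rw [hδ, ← Real.rpow_natCast, ← Real.rpow_mul (by positivity)]
    norm_num
    rw [hlam]; field_simp
  have hδ2 : δ ^ 2 = ((K : ℝ) / n) ^ (2 / 3 : ℝ) := by
    rw [hδ, ← Real.rpow_natCast, ← Real.rpow_mul (by positivity)]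
    norm_num
  -- Below `δ` noise dominates, since `lam * δ ^ 3 = 1`; below `a / K` variation within the market
  -- may hide the drift.
  set η₀ := max δ (a / K) with hη₀
  have hη₀0 : 0 < η₀ := lt_max_of_lt_left hδ0
  have hlamη₀ : 1 ≤ lam * η₀ ^ 3 := by
    rw [← hδ3]
    exact mul_le_mul_of_nonneg_left (pow_le_pow_left₀ hδ0.le (le_max_left _ _) 3) hlam0.le
  set D : (Fin n → ℝ × ℝ) → ℝ := fun data => |phat data k - q| with hD
  have hphatm : Measurable fun data => phat data k := (measurable_pi_apply k).comp hphat.1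
  have hDm : Measurable D := measurable_abs.comp (hphatm.sub_const q)
  have hcell : ∀ (S : Set (ℝ × ℝ)) (s t : ℝ), MeasurableSet S → s ≤ t →
      S ∩ unitSquare ⊆ Set.Ico s t ×ˢ B → n * M.law.real S ≤ ρ * lam * (t - s) := by
    intro S s t hS hst hsub
    have := mul_le_mul_of_nonneg_left (hM.law_real_le hC₀.le hCu.le hS hst hsub) hn0.le
    refine this.trans (le_of_eq ?_)
    rw [hlam]; ring
  have hshell : ∀ η, η₀ ≤ η → η ≤ 1 →
      (M.sampleLaw n).real {data | η ≤ D data ∧ D data ≤ 2 * η} ≤ C₂ / (lam * η ^ 3) := by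
    intro η hη hη1
    have hη0 : 0 < η := hη₀0.trans_le hη
    have hlamη : 1 ≤ lam * η ^ 3 := hlamη₀.trans
      (mul_le_mul_of_nonneg_left (pow_le_pow_left₀ hη₀0.le hη 3) hlam0.le)
    have hIco : ∀ s t : ℝ, MeasurableSet (Set.Ico s t ×ˢ B) := fun s t =>
      measurableSet_Ico.prod hBm
    have hup := htail (ν := M.law) (n := n) (A := fun u => Set.Ico q (q + u) ×ˢ B) (lam := lam)
      (η := η) (fun u => hIco _ _)
      (fun u v huv => Set.prod_mono (Set.Ico_subset_Ico_right (by linarith)) le_rfl)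
      (by simp) (fun u v hu huv => by
        refine (hcell _ (q + u) (q + v) ((hIco _ _).diff (hIco _ _)) (by linarith) ?_).trans
          (le_of_eq (by ring))
        rintro z ⟨⟨⟨hz1, hz2⟩, hz3⟩, -⟩
        exact ⟨⟨not_lt.mp fun h => hz3 ⟨⟨hz1.1, h⟩, hz2⟩, hz1.2⟩, hz2⟩) hη0 hη1 hlamη
    have hdown := htail (ν := M.law) (n := n) (A := fun u => Set.Ico (q - u) q ×ˢ B) (lam := lam)
      (η := η) (fun u => hIco _ _)
      (fun u v huv => Set.prod_mono (Set.Ico_subset_Ico_left (by linarith)) le_rfl)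
      (by simp) (fun u v hu huv => by
        refine (hcell _ (q - v) (q - u) ((hIco _ _).diff (hIco _ _)) (by linarith) ?_).trans
          (le_of_eq (by ring))
        rintro z ⟨⟨⟨hz1, hz2⟩, hz3⟩, -⟩
        exact ⟨⟨hz1.1, not_le.mp fun h => hz3 ⟨⟨h, hz1.2⟩, hz2⟩⟩, hz2⟩) hη0 hη1 hlamη
    have hTm : MeasurableSet (Set.Ici q ×ˢ B) := measurableSet_Ici.prod hBm
    have hfix : (M.sampleLaw n).real
        {data | c * lam * η / 4 ≤ |countDeviation M.law (Set.Ici q ×ˢ B) data|}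
          ≤ 32 * ρ / c ^ 2 / (lam * η ^ 3) := by
      refine (measure_countDeviation_ge_le hTm (by positivity)).trans ?_
      -- The half-open interval `[0, 2)` covers all valuations, including the endpoint `1`.
      have h1 : n * M.law.real (Set.Ici q ×ˢ B) ≤ ρ * lam * (2 - 0) :=
        hcell _ 0 2 hTm (by norm_num) fun z hz =>
          ⟨⟨hz.2.1.1, hz.2.1.2.trans_lt (by norm_num)⟩, hz.1.2⟩
      calc n * M.law.real (Set.Ici q ×ˢ B) / (c * lam * η / 4) ^ 2
          ≤ ρ * lam * (2 - 0) / (c * lam * η / 4) ^ 2 := by gcongr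
        _ = 32 * ρ / c ^ 2 / (lam * η ^ 2) := by field_simp; ring
        _ ≤ 32 * ρ / c ^ 2 / (lam * η ^ 3) := by
          refine div_le_div_of_nonneg_left (by positivity) (by positivity) ?_
          exact mul_le_mul_of_nonneg_left (pow_le_pow_of_le_one hη0.le hη1 (by norm_num)) hlam0.le
    -- The thresholds split the drift `c * lam * η ^ 2` evenly: the local increments get half, and
    -- the fixed set, multiplied by a distance of at most `2 * η`, gets the other half.
    set E₁ : Set (Fin n → ℝ × ℝ) := {z | ∃ u ∈ Set.Icc 0 (2 * η),
      c / 2 * lam * η ^ 2 < |countDeviation M.law (Set.Ico q (q + u) ×ˢ B) z|} with hE₁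
    set E₂ : Set (Fin n → ℝ × ℝ) := {z | ∃ u ∈ Set.Icc 0 (2 * η),
      c / 2 * lam * η ^ 2 < |countDeviation M.law (Set.Ico (q - u) q ×ˢ B) z|} with hE₂
    set E₃ : Set (Fin n → ℝ × ℝ) :=
      {data | c * lam * η / 4 ≤ |countDeviation M.law (Set.Ici q ×ˢ B) data|} with hE₃
    have hsub : {data | η ≤ D data ∧ D data ≤ 2 * η} ⊆ (E₁ ∪ E₂) ∪ E₃ := by
      rintro data ⟨hd1, hd2⟩
      by_contra hcon
      simp only [Set.mem_union, not_or] at hcon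
      obtain ⟨⟨h1, h2⟩, h3⟩ := hcon
      have hmem : D data ∈ Set.Icc 0 (2 * η) := ⟨abs_nonneg _, hd2⟩
      have h1' : |countDeviation M.law (Set.Ico q (q + D data) ×ˢ B) data| ≤ c / 2 * lam * η ^ 2 :=
        not_lt.mp fun h => h1 ⟨_, hmem, h⟩
      have h2' : |countDeviation M.law (Set.Ico (q - D data) q ×ˢ B) data| ≤ c / 2 * lam * η ^ 2 :=
        not_lt.mp fun h => h2 ⟨_, hmem, h⟩
      have h3' : |countDeviation M.law (Set.Ici q ×ˢ B) data| < c * lam * η / 4 := not_le.mp h3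
      have hdr := hM.market_revenue_drift hC₀.le hCs hCb.le hCl hp hx₀ (hphat.2 data k).1
        ((le_max_right _ _).trans (hη.trans hd1))
      rw [neg_mul, neg_mul] at hdr
      have hdev := drift_le_deviation hBm (hphat.2 data k).1 (hphat.mul_sum_le data k hqI) hdr
      have h4 := max_le h1' h2'
      have h5 : D data * |countDeviation M.law (Set.Ici q ×ˢ B) data|
          < 2 * η * (c * lam * η / 4) :=
        mul_lt_mul' hd2 h3' (abs_nonneg _) (by positivity)
      have h6 : η ^ 2 ≤ (phat data k - q) ^ 2 := by
        rw [← sq_abs (phat data k - q)]; exact pow_le_pow_left₀ hη0.le hd1 2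
      have h7 : n * (c * (1 / K) * (phat data k - q) ^ 2)
          = c * lam * (phat data k - q) ^ 2 := by rw [hlam]; ring
      have h8 := mul_le_mul_of_nonneg_left h6 (by positivity : 0 ≤ c * lam)
      rw [h7] at hdev
      simp only [hD] at h4 h5
      linarith
    refine (measureReal_mono hsub (measure_ne_top _ _)).trans
      ((measureReal_union_le _ _).trans ?_)
    refine (add_le_add ((measureReal_union_le _ _).trans (add_le_add hup hdown)) hfix).trans
      (le_of_eq ?_)
    rw [hC₂]; ring
  have hint := integral_sq_le_of_shell_bound hDm (fun _ => abs_nonneg _) (fun data => by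
    have h1 := (hphat.2 data k).1
    simp only [hD]
    rw [abs_le]; constructor <;> linarith [h1.1, h1.2, hqI.1, hqI.2]) hC₂0 hη₀0 hlamη₀ hshell
  simp only [hD, sq_abs] at hint
  refine hint.trans ?_
  have h1 : η₀ ^ 2 ≤ δ ^ 2 + (a / K) ^ 2 := by
    rcases max_choice δ (a / K) with h | h <;> rw [hη₀, h] <;> nlinarith [sq_nonneg δ, sq_nonneg (a / K)]
  rw [← hδ2]
  have h2 : (a / K) ^ 2 = a ^ 2 * (1 / (K : ℝ) ^ 2) := by rw [div_pow]; ring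
  rw [h2] at h1
  have h3 : 0 ≤ 1 / (K : ℝ) ^ 2 := by positivity
  have h4 : δ ^ 2 + a ^ 2 * (1 / (K : ℝ) ^ 2) ≤ (1 + a ^ 2) * (δ ^ 2 + 1 / (K : ℝ) ^ 2) := by
    nlinarith [sq_nonneg δ, sq_nonneg a, mul_nonneg (sq_nonneg a) (sq_nonneg δ)]
  calc η₀ ^ 2 * (1 + 8 * C₂)
      ≤ ((1 + a ^ 2) * (δ ^ 2 + 1 / (K : ℝ) ^ 2)) * (1 + 8 * C₂) :=
        mul_le_mul_of_nonneg_right (h1.trans h4) (by positivity)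
    _ = _ := by ring

end JointModel

/-! ### From price error to revenue loss -/

lemma exists_mem_market {K : ℕ} (hK : 0 < K) {x : ℝ} (hx : x ∈ Set.Ico (0 : ℝ) 1) :
    ∃ k : Fin K, x ∈ market K k := by
  have hK0 : (0 : ℝ) < K := by exact_mod_cast hK
  have h0 : 0 ≤ x * K := mul_nonneg hx.1 hK0.le
  have hlt : ⌊x * K⌋₊ < K := by
    rw [Nat.floor_lt h0]
    exact mul_lt_of_lt_one_left hK0 hx.2
  refine ⟨⟨⌊x * K⌋₊, hlt⟩, ?_, ?_⟩
  · rw [div_le_iff₀ hK0]; exact Nat.floor_le h0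
  · rw [lt_div_iff₀ hK0]; exact Nat.lt_floor_add_one _

lemma eq_of_mem_market {K : ℕ} {k l : Fin K} {x : ℝ} (hk : x ∈ market K k) (hl : x ∈ market K l) :
    k = l := by
  have hK0 : (0 : ℝ) < K := by exact_mod_cast k.pos
  have key : ∀ i j : Fin K, x ∈ market K i → x ∈ market K j → (i : ℕ) ≤ j := by
    intro i j hi hj
    have h1 := hi.1.trans_lt hj.2
    rw [div_lt_div_iff_of_pos_right hK0] at h1
    exact Nat.lt_succ_iff.mp (by exact_mod_cast h1)
  exact Fin.ext (le_antisymm (key k l hk hl) (key l k hl hk))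

lemma marketPricing_eq {K : ℕ} (p : Fin K → ℝ) {k : Fin K} {x : ℝ} (hx : x ∈ market K k) :
    marketPricing p x = p k := by
  unfold marketPricing
  rw [Finset.sum_eq_single k]
  · exact Set.indicator_of_mem hx _
  · intro l _ hl
    exact Set.indicator_of_notMem (fun h => hl (eq_of_mem_market h hx)) _
  · simp

lemma marketPricing_mem_Icc {K : ℕ} {p : Fin K → ℝ} (hp : ∀ k, p k ∈ Set.Icc (0 : ℝ) 1) (x : ℝ) :
    marketPricing p x ∈ Set.Icc (0 : ℝ) 1 := by
  by_cases h : ∃ k : Fin K, x ∈ market K k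
  · obtain ⟨k, hk⟩ := h
    rw [marketPricing_eq p hk]; exact hp k
  · have : marketPricing p x = 0 :=
      Finset.sum_eq_zero fun k _ => Set.indicator_of_notMem (fun hk => h ⟨k, hk⟩) _
    rw [this]; simp

lemma measurable_marketPricing {Ω : Type*} [MeasurableSpace Ω] {K : ℕ} {phat : Ω → Fin K → ℝ}
    (h : Measurable phat) : Measurable fun w : Ω × ℝ => marketPricing (phat w.1) w.2 := by
  refine Finset.measurable_sum _ fun k _ => ?_
  have h1 : Measurable fun w : Ω × ℝ => phat w.1 k :=
    (measurable_pi_apply k).comp (h.comp measurable_fst)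
  exact h1.indicator (measurable_snd (measurableSet_market K k))

namespace JointModel

variable {M : JointModel} {C₀ Cs Cb Cu Cl : ℝ}

lemma measurable_revenue_comp (M : JointModel) {Ω : Type*} [MeasurableSpace Ω] {p : Ω → ℝ}
    (hp : Measurable p) (x : ℝ) : Measurable fun ω => M.revenue (p ω) x :=
  M.measurable_revenue.comp (hp.prodMk measurable_const)

lemma InClass.integrable_revenue_marketPricing (hM : M.InClass C₀ Cs Cb Cu Cl) {n K : ℕ}
    {phat : (Fin n → ℝ × ℝ) → Fin K → ℝ} (hphat : IsKMarketsERM phat) {x : ℝ}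
    (hx : x ∈ Set.Icc (0 : ℝ) 1) :
    Integrable (fun data => M.revenue (marketPricing (phat data) x) x) (M.sampleLaw n) := by
  have := hM.isProbabilityMeasure_law
  have hprob : IsProbabilityMeasure (M.sampleLaw n) := by unfold sampleLaw; infer_instance
  have h1 : Measurable fun data => marketPricing (phat data) x :=
    (measurable_marketPricing hphat.1).comp measurable_prodMk_right
  have h2 : Measurable fun data => M.revenue (marketPricing (phat data) x) x :=
    M.measurable_revenue_comp h1 x
  refine integrable_of_abs_le (B := 1) h2 fun data => ?_
  have h := hM.revenue_mem_Icc hx (marketPricing_mem_Icc (fun k => (hphat.2 data k).1) x)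
  rw [abs_of_nonneg h.1]; exact h.2

/-- The expected revenue loss of the `K`-markets ERM strategy at a covariate value. -/
theorem exists_pointwise_revenue_loss_le (C₀ Cs Cb Cu Cl : ℝ) (hC₀ : 0 < C₀) (hCs : 0 < Cs)
    (hCb : 0 < Cb) (hCu : 0 < Cu) (hCl : 0 < Cl) :
    ∃ C : ℝ, 0 < C ∧ ∀ n K : ℕ, 0 < K → K ≤ n →
      ∀ phat : (Fin n → ℝ × ℝ) → Fin K → ℝ, IsKMarketsERM phat →
      ∀ M : JointModel, M.InClass C₀ Cs Cb Cu Cl →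
      ∀ pstar : ℝ → ℝ, (∀ x ∈ Set.Icc (0 : ℝ) 1, M.IsOptimalPrice x (pstar x)) →
      ∀ x₀ ∈ Set.Ico (0 : ℝ) 1,
        M.revenue (pstar x₀) x₀
            - ∫ data, M.revenue (marketPricing (phat data) x₀) x₀ ∂(M.sampleLaw n)
          ≤ C * (((K : ℝ) / n) ^ (2 / 3 : ℝ) + 1 / (K : ℝ) ^ 2) := by
  obtain ⟨C, hC, h⟩ := exists_integral_sq_sub_le C₀ Cs Cb Cu Cl hC₀ hCs hCb hCu hCl
  refine ⟨(2 + 3 * C₀) / 2 * C, by positivity, ?_⟩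
  intro n K hK hKn phat hphat M hM pstar hp x₀ hx₀
  have := hM.isProbabilityMeasure_law
  have hprob : IsProbabilityMeasure (M.sampleLaw n) := by unfold sampleLaw; infer_instance
  obtain ⟨k, hk⟩ := exists_mem_market hK hx₀
  have hx₀I : x₀ ∈ Set.Icc (0 : ℝ) 1 := Set.Ico_subset_Icc_self hx₀
  have hint := hM.integrable_revenue_marketPricing hphat hx₀I
  have hq := (hp x₀ hx₀I).1
  have hsq : Integrable (fun data => (phat data k - pstar x₀) ^ 2) (M.sampleLaw n) := by
    refine integrable_of_abs_le (B := 1)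
      ((((measurable_pi_apply k).comp hphat.1).sub_const _).pow_const 2) fun data => ?_
    have h1 := (hphat.2 data k).1
    rw [abs_pow]
    refine pow_le_one₀ (abs_nonneg _) ?_
    rw [abs_le]; constructor <;> linarith [h1.1, h1.2, hq.1, hq.2]
  have e : M.revenue (pstar x₀) x₀
      - ∫ data, M.revenue (marketPricing (phat data) x₀) x₀ ∂(M.sampleLaw n)
      = ∫ data, (M.revenue (pstar x₀) x₀ - M.revenue (marketPricing (phat data) x₀) x₀)
        ∂(M.sampleLaw n) := by
    rw [integral_sub (integrable_const _) hint]; simp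
  rw [e]
  have hle : ∫ data, (M.revenue (pstar x₀) x₀ - M.revenue (marketPricing (phat data) x₀) x₀)
        ∂(M.sampleLaw n)
      ≤ ∫ data, (2 + 3 * C₀) / 2 * (phat data k - pstar x₀) ^ 2 ∂(M.sampleLaw n) := by
    refine integral_mono ((integrable_const _).sub hint) (hsq.const_mul _) fun data => ?_
    beta_reduce
    rw [marketPricing_eq (phat data) hk]
    exact hM.revenue_optimal_sub_le hC₀.le hx₀I (hp x₀ hx₀I) (hphat.2 data k).1
  rw [integral_const_mul] at hle
  refine hle.trans ?_
  rw [mul_assoc]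
  exact mul_le_mul_of_nonneg_left (h n K hK hKn phat hphat M hM pstar hp k x₀ hk) (by positivity)

/-- A uniform bound on the pointwise loss bounds the loss in expected revenue. -/
lemma InClass.expectedRevenue_loss_le (hM : M.InClass C₀ Cs Cb Cu Cl) {n K : ℕ}
    {phat : (Fin n → ℝ × ℝ) → Fin K → ℝ} (hphat : IsKMarketsERM phat) {pstar : ℝ → ℝ}
    (hp : pstar ∈ pricingFunctions) {b : ℝ}
    (hb : ∀ x₀ ∈ Set.Ico (0 : ℝ) 1, M.revenue (pstar x₀) x₀
      - ∫ data, M.revenue (marketPricing (phat data) x₀) x₀ ∂(M.sampleLaw n) ≤ b) :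
    M.expectedRevenue pstar
      - ∫ data, M.expectedRevenue (marketPricing (phat data)) ∂(M.sampleLaw n) ≤ b := by
  have := hM.isProbabilityMeasure_law
  have hprob : IsProbabilityMeasure (M.sampleLaw n) := by unfold sampleLaw; infer_instance
  set μ := M.sampleLaw n
  set V : Measure ℝ := volume.restrict (Set.Ioc (0 : ℝ) 1) with hV
  have hIoc : ∀ᵐ x ∂V, x ∈ Set.Icc (0 : ℝ) 1 := by
    filter_upwards [ae_restrict_mem measurableSet_Ioc] with x hx using Set.Ioc_subset_Icc_self hx
  have hjoint : Integrable (fun w : (Fin n → ℝ × ℝ) × ℝ =>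
      M.revenue (marketPricing (phat w.1) w.2) w.2 * M.margDensity w.2) (μ.prod V) := by
    refine Integrable.of_bound (C := Cu) ?_ ?_
    · exact ((M.measurable_revenue.comp ((measurable_marketPricing hphat.1).prodMk
        measurable_snd)).mul (M.measurable_margDensity.comp measurable_snd)).aestronglyMeasurable
    · have h1 : ∀ᵐ w ∂(μ.prod V), w.2 ∈ Set.Icc (0 : ℝ) 1 :=
        Measure.quasiMeasurePreserving_snd.ae hIoc
      filter_upwards [h1] with w hw
      have h2 := hM.revenue_mem_Icc hw
        (marketPricing_mem_Icc (fun k => (hphat.2 w.1 k).1) w.2)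
      have h3 := M.margDensity_nonneg _ hw
      rw [Real.norm_eq_abs, abs_mul, abs_of_nonneg h2.1, abs_of_nonneg h3]
      exact (mul_le_of_le_one_left h3 h2.2).trans (hM.marginal _ hw).2
  have hstar : Integrable (fun x => M.revenue (pstar x) x * M.margDensity x) V := by
    refine (hM.integrableOn_mul_margDensity (g := fun x => M.revenue (pstar x) x) (c := 1)
      (M.measurable_revenue.comp (hp.1.prodMk measurable_id)) (fun x hx => ?_) measurableSet_Ioc
      Set.Ioc_subset_Icc_self)
    have h := hM.revenue_mem_Icc hx (hp.2 x hx)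
    rw [abs_of_nonneg h.1]; exact h.2
  have hm : Integrable M.margDensity V := by
    have := hM.integrableOn_mul_margDensity (g := fun _ => 1) (c := 1) measurable_const
      (fun x _ => by simp) measurableSet_Ioc (Set.Ioc_subset_Icc_self (a := (0 : ℝ)) (b := 1))
    simp only [one_mul] at this
    exact this
  have hone : ∫ x, M.margDensity x ∂V = 1 := by
    rw [hV, ← intervalIntegral.integral_of_le zero_le_one]; exact M.integral_margDensity
  simp only [expectedRevenue, intervalIntegral.integral_of_le zero_le_one]
  rw [integral_integral_swap hjoint, ← integral_sub hstar hjoint.integral_prod_right]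
  have hle : ∫ x, (M.revenue (pstar x) x * M.margDensity x
        - ∫ data, M.revenue (marketPricing (phat data) x) x * M.margDensity x ∂μ) ∂V
      ≤ ∫ x, b * M.margDensity x ∂V := by
    refine integral_mono_ae (hstar.sub hjoint.integral_prod_right) (hm.const_mul b) ?_
    -- The covariate `1` belongs to no market and is discarded as a null set.
    filter_upwards [hIoc, ae_restrict_of_ae (Measure.ae_ne volume (1 : ℝ))] with x hx hx1
    rw [integral_mul_const, ← sub_mul]
    exact mul_le_mul_of_nonneg_right (hb x ⟨hx.1, lt_of_le_of_ne hx.2 hx1⟩)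
      (M.margDensity_nonneg x hx)
  rw [integral_const_mul, hone, mul_one] at hle
  exact hle

end JointModel

/-! ### Balancing the two error terms -/

/-- The order of the rate when the number of markets is of the order `n ^ (1 / 4)`. -/
lemma rate_balanced {a b : ℝ} (ha : 0 < a) (hb : 0 < b) :
    ∃ c₁ c₂ : ℝ, 0 < c₁ ∧ 0 < c₂ ∧ ∀ n K : ℕ, 0 < n → 0 < K →
      a * (n : ℝ) ^ (1 / 4 : ℝ) ≤ K → (K : ℝ) ≤ b * (n : ℝ) ^ (1 / 4 : ℝ) →
        c₁ * (n : ℝ) ^ (-(1 / 2) : ℝ) ≤ ((K : ℝ) / n) ^ (2 / 3 : ℝ) + 1 / (K : ℝ) ^ 2 ∧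
        ((K : ℝ) / n) ^ (2 / 3 : ℝ) + 1 / (K : ℝ) ^ 2 ≤ c₂ * (n : ℝ) ^ (-(1 / 2) : ℝ) := by
  -- The lower bound uses only the noise term. For the upper bound, `K ≤ b * n ^ (1/4)` controls the
  -- noise and `a * n ^ (1/4) ≤ K` the bias.
  refine ⟨a ^ (2 / 3 : ℝ), b ^ (2 / 3 : ℝ) + 1 / a ^ 2, by positivity, by positivity, ?_⟩
  intro n K hn hK h1 h2
  have hn0 : (0 : ℝ) < n := by exact_mod_cast hn
  have hK0 : (0 : ℝ) < K := by exact_mod_cast hK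
  have key : ∀ t : ℝ, 0 < t → (t * (n : ℝ) ^ (1 / 4 : ℝ) / n) ^ (2 / 3 : ℝ)
      = t ^ (2 / 3 : ℝ) * (n : ℝ) ^ (-(1 / 2) : ℝ) := by
    intro t ht
    have e : t * (n : ℝ) ^ (1 / 4 : ℝ) / n = t * (n : ℝ) ^ (-(3 / 4) : ℝ) := by
      rw [mul_div_assoc, ← Real.rpow_sub_one hn0.ne']; norm_num
    rw [e, Real.mul_rpow ht.le (by positivity), ← Real.rpow_mul hn0.le]
    norm_num
  have hsq : ((n : ℝ) ^ (1 / 4 : ℝ)) ^ 2 * (n : ℝ) ^ (-(1 / 2) : ℝ) = 1 := by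
    rw [← Real.rpow_natCast, ← Real.rpow_mul hn0.le, ← Real.rpow_add hn0]
    norm_num
  constructor
  · have h3 : (a * (n : ℝ) ^ (1 / 4 : ℝ) / n) ^ (2 / 3 : ℝ) ≤ ((K : ℝ) / n) ^ (2 / 3 : ℝ) :=
      Real.rpow_le_rpow (by positivity) (by gcongr) (by norm_num)
    rw [key a ha] at h3
    have : 0 ≤ 1 / (K : ℝ) ^ 2 := by positivity
    linarith
  · have h3 : ((K : ℝ) / n) ^ (2 / 3 : ℝ) ≤ (b * (n : ℝ) ^ (1 / 4 : ℝ) / n) ^ (2 / 3 : ℝ) :=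
      Real.rpow_le_rpow (by positivity) (by gcongr) (by norm_num)
    rw [key b hb] at h3
    have h4 : 1 / (K : ℝ) ^ 2 ≤ 1 / (a * (n : ℝ) ^ (1 / 4 : ℝ)) ^ 2 := by gcongr
    have h5 : 1 / (a * (n : ℝ) ^ (1 / 4 : ℝ)) ^ 2 = 1 / a ^ 2 * (n : ℝ) ^ (-(1 / 2) : ℝ) := by
      rw [div_eq_iff (by positivity), mul_pow]
      have : 1 / a ^ 2 * a ^ 2 = 1 := by field_simp
      calc (1 : ℝ) = (1 / a ^ 2 * a ^ 2) * (((n : ℝ) ^ (1 / 4 : ℝ)) ^ 2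
            * (n : ℝ) ^ (-(1 / 2) : ℝ)) := by rw [this, hsq, one_mul]
        _ = _ := by ring
    rw [add_mul]
    linarith
theorem theorem4 :
    (∀ C₀ Cs Cb Cu Cl : ℝ, 0 < C₀ → 0 < Cs → 0 < Cb → 0 < Cu → 0 < Cl →
      ∃ C : ℝ, 0 < C ∧ ∀ n K : ℕ, 0 < K → K ≤ n →
        ∀ phat : (Fin n → ℝ × ℝ) → Fin K → ℝ, IsKMarketsERM phat →
        ∀ M : JointModel, M.InClass C₀ Cs Cb Cu Cl →
        ∀ pstar : ℝ → ℝ, M.IsOptimalPricing pstar →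
          (∀ x₀ ∈ Set.Ico (0 : ℝ) 1,
            M.revenue (pstar x₀) x₀
                - ∫ data, M.revenue (marketPricing (phat data) x₀) x₀ ∂(M.sampleLaw n)
              ≤ C * (((K : ℝ) / n) ^ (2 / 3 : ℝ) + 1 / (K : ℝ) ^ 2)) ∧
          (M.expectedRevenue pstar
                - ∫ data, M.expectedRevenue (marketPricing (phat data)) ∂(M.sampleLaw n)
              ≤ C * (((K : ℝ) / n) ^ (2 / 3 : ℝ) + 1 / (K : ℝ) ^ 2))) ∧
    (∀ a b : ℝ, 0 < a → 0 < b →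
      ∃ c₁ c₂ : ℝ, 0 < c₁ ∧ 0 < c₂ ∧ ∀ n K : ℕ, 0 < n → 0 < K →
        a * (n : ℝ) ^ (1 / 4 : ℝ) ≤ K → (K : ℝ) ≤ b * (n : ℝ) ^ (1 / 4 : ℝ) →
          c₁ * (n : ℝ) ^ (-(1 / 2) : ℝ) ≤ ((K : ℝ) / n) ^ (2 / 3 : ℝ) + 1 / (K : ℝ) ^ 2 ∧
          ((K : ℝ) / n) ^ (2 / 3 : ℝ) + 1 / (K : ℝ) ^ 2 ≤ c₂ * (n : ℝ) ^ (-(1 / 2) : ℝ)) := by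
  refine ⟨fun C₀ Cs Cb Cu Cl hC₀ hCs hCb hCu hCl => ?_, fun a b ha hb => rate_balanced ha hb⟩
  obtain ⟨C, hC, h⟩ :=
    JointModel.exists_pointwise_revenue_loss_le C₀ Cs Cb Cu Cl hC₀ hCs hCb hCu hCl
  refine ⟨C, hC, fun n K hK hKn phat hphat M hM pstar hpstar => ?_⟩
  have hpt := h n K hK hKn phat hphat M hM pstar hpstar.2.2
  exact ⟨hpt, hM.expectedRevenue_loss_le hphat hpstar.1 hpt⟩
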